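/- Fix a free ultrafilter $\omega$ on $\mathbb{N}$. For a unital $C^*$-algebra $A$ let $A_\omega=\ell^\infty(\mathbb{N},A)/\{(a_k)_k:\lim_{k\to\omega}\|a_k\|=0\}$, regard $A\subset A_\omega$ as the classes of constant sequences, and for an action $\alpha$ of a group on $A$ let $\alpha_\omega$ be the induced action on $A_\omega$. For positive $a,b$ in a $C^*$-algebra $C$ write $a\lesssim b$ if there are $x_k\in C$ with $\|x_kbx_k^*-a\|\to 0$. A completely positive map $\psi$ has order zero if $\psi(a)\psi(b)=\psi(b)\psi(a)=0$ whenever $a,b\ge 0$ and $ab=ba=0$. Let $\alpha:G\to\operatorname{Aut}(A)$ and $\beta:G\to\operatorname{Aut}(B)$ be actions of a group $G$ on unital $C^*$-algebras. An equivariant $*$-homomorphism $\phi:(A,\alpha)\to(B,\beta)$ (not necessarily unital) is called $G$-tracially sequentially-split by order zero if for every nonzero positive $x\in A_\omega$ there exist an equivariant completely positive order zero map $\psi:(B,\beta)\to(A_\omega,\alpha_\omega)$ and a positive element $g\in A_\omega\cap A'$ such that $\psi(\phi(a))=ag=ga$ for all $a\in A$ and $1_{A_\omega}-g\lesssim x$.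 **Lemma.** Let $G$ be a finite group, let $\alpha:G\to\operatorname{Aut}(A)$ and $\beta:G\to\operatorname{Aut}(B)$ be actions on unital separable simple infinite-dimensional $C^*$-algebras $A$ and $B$, and let $\phi:(A,\alpha)\to(B,\beta)$ be an equivariant $*$-homomorphism. Let $n\ge 1$ be an integer and let $\rho:G\to\operatorname{Aut}(M_n)$ be any action of $G$ by $*$-automorphisms on $M_n=M_n(\mathbb{C})$. Then $\phi$ is $G$-tracially sequentially-split by order zero if and only if $\phi\otimes\operatorname{id}_{M_n}:(A\otimes M_n,\alpha\otimes\rho)\to(B\otimes M_n,\beta\otimes\rho)$ is $G$-tracially sequentially-split by order zero. -/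

import Mathlib

open Filter Topology
open scoped ENNReal CStarAlgebra

noncomputable section

/-! ### The norm ultrapower of a unital C⋆-algebra -/

section Ultrapower

variable (ω : Ultrafilter ℕ) (A : Type*) [CStarAlgebra A] [Nontrivial A]

/-- The closed two-sided ideal `c_ω(ℕ, A)` of the C⋆-algebra `ℓ^∞(ℕ, A)` of bounded sequences. -/
def vanishingIdeal : Ideal (lp (fun _ : ℕ => A) ∞) where
  carrier := {a | Tendsto (fun n => ‖a n‖) ω (𝓝 0)}
  zero_mem' := by simp
  add_mem' {a b} ha hb := by
    refine squeeze_zero (fun n => norm_nonneg _) (fun n => norm_add_le (a n) (b n)) ?_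
    simpa using Tendsto.add ha hb
  smul_mem' c a ha := by
    refine squeeze_zero (g := fun n => ‖c‖ * ‖a n‖) (fun n => norm_nonneg _) (fun n => ?_) ?_
    · exact (norm_mul_le (c n) (a n)).trans
        (mul_le_mul_of_nonneg_right (lp.norm_apply_le_norm ENNReal.top_ne_zero c n)
          (norm_nonneg _))
    · simpa using Tendsto.const_mul ‖c‖ ha

variable {A} in
theorem mem_vanishingIdeal {a : lp (fun _ : ℕ => A) ∞} :
    a ∈ vanishingIdeal ω A ↔ Tendsto (fun n => ‖a n‖) ω (𝓝 0) := Iff.rfl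

instance vanishingIdeal_isTwoSided : (vanishingIdeal ω A).IsTwoSided where
  mul_mem_of_left {a} c ha := by
    refine squeeze_zero (g := fun n => ‖a n‖ * ‖c‖) (fun n => norm_nonneg _) (fun n => ?_) ?_
    · exact (norm_mul_le (a n) (c n)).trans
        (mul_le_mul_of_nonneg_left (lp.norm_apply_le_norm ENNReal.top_ne_zero c n)
          (norm_nonneg _))
    · simpa using Tendsto.mul_const ‖c‖ ha

variable {A} in
theorem star_mem_vanishingIdeal {a : lp (fun _ : ℕ => A) ∞} (ha : a ∈ vanishingIdeal ω A) :
    star a ∈ vanishingIdeal ω A := by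
  rw [mem_vanishingIdeal] at ha ⊢
  simpa [lp.star_apply] using ha

/-- The norms of a bounded sequence converge along the ultrafilter. -/
theorem exists_tendsto_norm {A : Type*} [CStarAlgebra A] (a : lp (fun _ : ℕ => A) ∞) :
    ∃ L : ℝ, Tendsto (fun n => ‖a n‖) ω (𝓝 L) := by
  have hK : IsCompact (Set.Icc (0 : ℝ) ‖a‖) := isCompact_Icc
  have hle : ((ω.map fun n => ‖a n‖ : Ultrafilter ℝ) : Filter ℝ) ≤ 𝓟 (Set.Icc (0 : ℝ) ‖a‖) := by
    rw [le_principal_iff]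
    exact Filter.Eventually.of_forall (f := (ω : Filter ℕ)) fun n =>
      ⟨norm_nonneg _, lp.norm_apply_le_norm ENNReal.top_ne_zero a n⟩
  obtain ⟨L, -, hL⟩ := hK.ultrafilter_le_nhds _ hle
  exact ⟨L, hL⟩

variable {A} in
/-- The quotient norm of the class of `a` is `lim_ω ‖a n‖`. -/
theorem norm_quotient_mk_eq {a : lp (fun _ : ℕ => A) ∞} {L : ℝ}
    (hL : Tendsto (fun n => ‖a n‖) ω (𝓝 L)) :
    ‖(Submodule.Quotient.mk a : lp (fun _ : ℕ => A) ∞ ⧸ vanishingIdeal ω A)‖ = L := by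
  apply le_antisymm
  · refine le_of_forall_pos_le_add fun ε hε => ?_
    have hL0 : 0 ≤ L := ge_of_tendsto' hL fun n => norm_nonneg _
    have hS : ∀ᶠ n in (ω : Filter ℕ), ‖a n‖ < L + ε := hL.eventually_lt_const (by linarith)
    classical
    let b : lp (fun _ : ℕ => A) ∞ := ⟨fun n => if ‖a n‖ < L + ε then a n else 0, by
      refine memℓp_infty ⟨L + ε, ?_⟩
      rintro _ ⟨n, rfl⟩
      dsimp only
      split_ifs with h
      · exact h.le
      · simpa using (by linarith : 0 ≤ L + ε)⟩
    have hb : ∀ n, b n = if ‖a n‖ < L + ε then a n else 0 := fun n => rfl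
    have hab : (Submodule.Quotient.mk a : lp (fun _ : ℕ => A) ∞ ⧸ vanishingIdeal ω A)
        = Submodule.Quotient.mk b := by
      rw [Submodule.Quotient.eq, mem_vanishingIdeal]
      refine tendsto_const_nhds.congr' ?_
      filter_upwards [hS] with n hn
      simp [hb, hn]
    rw [hab]
    refine (Submodule.Quotient.norm_mk_le _ b).trans ?_
    refine lp.norm_le_of_forall_le (by linarith) fun n => ?_
    rw [hb]
    split_ifs with h
    · exact h.le
    · simpa using (by linarith : 0 ≤ L + ε)
  · refine le_of_forall_pos_le_add fun ε hε => ?_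
    obtain ⟨m, hm, hlt⟩ := Submodule.Quotient.norm_mk_lt
      (Submodule.Quotient.mk a : lp (fun _ : ℕ => A) ∞ ⧸ vanishingIdeal ω A) hε
    rw [Submodule.Quotient.eq, mem_vanishingIdeal] at hm
    refine le_trans ?_ hlt.le
    have h1 : Tendsto (fun n => ‖a n‖ - ‖(m - a) n‖) ω (𝓝 L) := by simpa using hL.sub hm
    refine le_of_tendsto' h1 fun n => ?_
    have h2 := norm_sub_norm_le (a n) (-((m - a) n))
    have h3 : a n - -((m - a) n) = m n := by simp
    rw [h3, norm_neg] at h2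
    exact h2.trans (lp.norm_apply_le_norm ENNReal.top_ne_zero m n)

instance vanishingIdeal_isClosed :
    IsClosed (vanishingIdeal ω A : Set (lp (fun _ : ℕ => A) ∞)) := by
  have h : (vanishingIdeal ω A : Set (lp (fun _ : ℕ => A) ∞)) =
      (fun a => ‖(Submodule.Quotient.mk a :
        lp (fun _ : ℕ => A) ∞ ⧸ vanishingIdeal ω A)‖) ⁻¹' {0} := by
    ext a
    obtain ⟨L, hL⟩ := exists_tendsto_norm ω a
    simp only [SetLike.mem_coe, mem_vanishingIdeal, Set.mem_preimage, Set.mem_singleton_iff,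
      norm_quotient_mk_eq ω hL]
    exact ⟨fun h0 => tendsto_nhds_unique hL h0, fun h0 => h0 ▸ hL⟩
  rw [h]
  refine isClosed_singleton.preimage ?_
  refine (LipschitzWith.of_le_add_mul 1 fun a b => ?_ : LipschitzWith 1 _).continuous
  have h1 : (Submodule.Quotient.mk a : lp (fun _ : ℕ => A) ∞ ⧸ vanishingIdeal ω A)
      = Submodule.Quotient.mk b + Submodule.Quotient.mk (a - b) := by
    rw [← Submodule.Quotient.mk_add]; congr 1; abel
  rw [h1]
  refine (norm_add_le _ _).trans ?_
  have h2 := Submodule.Quotient.norm_mk_le (vanishingIdeal ω A) (a - b)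
  rw [NNReal.coe_one, one_mul, dist_eq_norm]
  gcongr

/-- The ultrapower C⋆-algebra `A_ω = ℓ^∞(ℕ, A) / c_ω(ℕ, A)`, with the quotient norm. -/
def Ultrapower : Type _ := lp (fun _ : ℕ => A) ∞ ⧸ vanishingIdeal ω A

namespace Ultrapower

instance instRing : Ring (Ultrapower ω A) :=
  inferInstanceAs (Ring (lp (fun _ : ℕ => A) ∞ ⧸ vanishingIdeal ω A))

instance instAlgebra : Algebra ℂ (Ultrapower ω A) :=
  inferInstanceAs (Algebra ℂ (lp (fun _ : ℕ => A) ∞ ⧸ vanishingIdeal ω A))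

instance instNormedAddCommGroup : NormedAddCommGroup (Ultrapower ω A) :=
  inferInstanceAs (NormedAddCommGroup (lp (fun _ : ℕ => A) ∞ ⧸ vanishingIdeal ω A))

instance instCompleteSpace : CompleteSpace (Ultrapower ω A) :=
  inferInstanceAs (CompleteSpace (lp (fun _ : ℕ => A) ∞ ⧸ vanishingIdeal ω A))

variable {A}

/-- The quotient map `π_ω : ℓ^∞(ℕ, A) → A_ω`. -/
def mk : lp (fun _ : ℕ => A) ∞ →ₐ[ℂ] Ultrapower ω A :=
  Ideal.Quotient.mkₐ ℂ (vanishingIdeal ω A)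

theorem mk_surjective : Function.Surjective (mk ω (A := A)) :=
  Ideal.Quotient.mkₐ_surjective ℂ (vanishingIdeal ω A)

theorem mk_eq_mk_iff {a b : lp (fun _ : ℕ => A) ∞} :
    mk ω a = mk ω b ↔ Tendsto (fun n => ‖a n - b n‖) ω (𝓝 0) := by
  refine (Ideal.Quotient.eq (I := vanishingIdeal ω A) (x := a) (y := b)).trans ?_
  rw [mem_vanishingIdeal]
  simp

theorem norm_mk {a : lp (fun _ : ℕ => A) ∞} {L : ℝ}
    (hL : Tendsto (fun n => ‖a n‖) ω (𝓝 L)) : ‖mk ω a‖ = L :=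
  norm_quotient_mk_eq ω hL

theorem tendsto_norm_mk (a : lp (fun _ : ℕ => A) ∞) :
    Tendsto (fun n => ‖a n‖) ω (𝓝 ‖mk ω a‖) := by
  obtain ⟨L, hL⟩ := exists_tendsto_norm ω a
  rwa [norm_mk ω hL]

variable (A)

instance instNormedRing : NormedRing (Ultrapower ω A) where
  __ := instRing ω A
  __ := instNormedAddCommGroup ω A
  norm_mul_le x y := by
    obtain ⟨a, rfl⟩ := mk_surjective ω x
    obtain ⟨b, rfl⟩ := mk_surjective ω y
    have h : mk ω a * mk ω b = mk ω (a * b) := (map_mul (mk ω) a b).symm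
    refine le_of_tendsto_of_tendsto' (h ▸ tendsto_norm_mk ω (a * b))
      ((tendsto_norm_mk ω a).mul (tendsto_norm_mk ω b)) fun n => ?_
    exact norm_mul_le (a n) (b n)

instance instNormedAlgebra : NormedAlgebra ℂ (Ultrapower ω A) where
  __ := instAlgebra ω A
  norm_smul_le c x := by
    obtain ⟨a, rfl⟩ := mk_surjective ω x
    have h : c • mk ω a = mk ω (c • a) := (map_smul (mk ω) c a).symm
    refine le_of_tendsto_of_tendsto' (h ▸ tendsto_norm_mk ω (c • a))
      ((tendsto_norm_mk ω a).const_mul ‖c‖) fun n => ?_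
    exact norm_smul_le c (a n)

/-- The involution of the ultrapower, induced by the pointwise one. -/
instance instStar : Star (Ultrapower ω A) where
  star := Quotient.lift (fun a => mk ω (star a)) fun a b hab => by
    have h : mk ω a = mk ω b := Quotient.sound hab
    rw [mk_eq_mk_iff] at h ⊢
    simpa [lp.star_apply, ← star_sub] using h

variable {A} in
theorem star_mk (a : lp (fun _ : ℕ => A) ∞) : star (mk ω a) = mk ω (star a) := rfl

instance instStarRing : StarRing (Ultrapower ω A) where
  star_involutive x := by
    obtain ⟨a, rfl⟩ := mk_surjective ω x
    simp only [star_mk, star_star]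
  star_mul x y := by
    obtain ⟨a, rfl⟩ := mk_surjective ω x
    obtain ⟨b, rfl⟩ := mk_surjective ω y
    rw [← map_mul, star_mk, star_mk, star_mk, star_mul, map_mul]
  star_add x y := by
    obtain ⟨a, rfl⟩ := mk_surjective ω x
    obtain ⟨b, rfl⟩ := mk_surjective ω y
    rw [← map_add, star_mk, star_mk, star_mk, star_add, map_add]

instance instCStarRing : CStarRing (Ultrapower ω A) where
  norm_mul_self_le x := by
    obtain ⟨a, rfl⟩ := mk_surjective ω x
    rw [star_mk, ← map_mul]
    refine le_of_tendsto_of_tendsto' ((tendsto_norm_mk ω a).mul (tendsto_norm_mk ω a))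
      (tendsto_norm_mk ω (star a * a)) fun n => ?_
    exact CStarRing.norm_mul_self_le (a n)

instance instStarModule : StarModule ℂ (Ultrapower ω A) where
  star_smul c x := by
    obtain ⟨a, rfl⟩ := mk_surjective ω x
    rw [← map_smul, star_mk, star_mk, star_smul, map_smul]

instance instCStarAlgebra : CStarAlgebra (Ultrapower ω A) where
  __ := instNormedRing ω A
  __ := instStarRing ω A
  __ := instCompleteSpace ω A
  __ := instCStarRing ω A
  __ := instNormedAlgebra ω A
  __ := instStarModule ω A

/-- Positivity in the ultrapower is the usual one of a C⋆-algebra: `0 ≤ x` if and only if `x` is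
self-adjoint with spectrum in `[0, ∞)`. -/
instance instPartialOrder : PartialOrder (Ultrapower ω A) := CStarAlgebra.spectralOrder _

instance instStarOrderedRing : StarOrderedRing (Ultrapower ω A) :=
  CStarAlgebra.spectralOrderedRing _

/-- The canonical embedding `ι : A → A_ω` as constant sequences. -/
def diag : A →⋆ₐ[ℂ] Ultrapower ω A where
  toFun a := mk ω ⟨fun _ => a, memℓp_infty ⟨‖a‖, by rintro _ ⟨n, rfl⟩; exact le_rfl⟩⟩
  map_one' := map_one (mk ω)
  map_mul' a b := map_mul (mk ω) ⟨fun _ => a, _⟩ ⟨fun _ => b, _⟩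
  map_zero' := map_zero (mk ω)
  map_add' a b := map_add (mk ω) ⟨fun _ => a, _⟩ ⟨fun _ => b, _⟩
  commutes' c := (mk ω).commutes c
  map_star' a := rfl

variable {A}
variable {B : Type*} [CStarAlgebra B] [Nontrivial B]

/-- Application of a ⋆-homomorphism to each term of a bounded sequence. -/
def mapSeq (f : A →⋆ₐ[ℂ] B) (a : lp (fun _ : ℕ => A) ∞) : lp (fun _ : ℕ => B) ∞ :=
  ⟨fun n => f (a n), memℓp_infty ⟨‖a‖, by
    rintro _ ⟨n, rfl⟩
    exact (NonUnitalStarAlgHom.norm_apply_le f (a n)).trans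
      (lp.norm_apply_le_norm ENNReal.top_ne_zero a n)⟩⟩

/-- The ⋆-homomorphism `f_ω : A_ω → B_ω` induced by a unital ⋆-homomorphism `f : A → B`. -/
def map (f : A →⋆ₐ[ℂ] B) : Ultrapower ω A →⋆ₐ[ℂ] Ultrapower ω B where
  toFun := Quotient.lift (fun a => mk ω (mapSeq f a)) fun a b hab => by
    have h : mk ω a = mk ω b := Quotient.sound hab
    rw [mk_eq_mk_iff] at h ⊢
    refine squeeze_zero (fun n => norm_nonneg _) (fun n => ?_) h
    have := NonUnitalStarAlgHom.norm_apply_le f (a n - b n)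
    rwa [map_sub] at this
  map_one' := by
    change mk ω (mapSeq f 1) = 1
    rw [← map_one (mk ω)]
    congr 1
    ext n
    exact map_one f
  map_mul' x y := by
    obtain ⟨a, rfl⟩ := mk_surjective ω x
    obtain ⟨b, rfl⟩ := mk_surjective ω y
    change mk ω (mapSeq f (a * b)) = mk ω (mapSeq f a) * mk ω (mapSeq f b)
    rw [← map_mul]
    congr 1
    ext n
    exact map_mul f (a n) (b n)
  map_zero' := by
    change mk ω (mapSeq f 0) = 0
    rw [← map_zero (mk ω)]
    congr 1
    ext n
    exact map_zero f
  map_add' x y := by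
    obtain ⟨a, rfl⟩ := mk_surjective ω x
    obtain ⟨b, rfl⟩ := mk_surjective ω y
    change mk ω (mapSeq f (a + b)) = mk ω (mapSeq f a) + mk ω (mapSeq f b)
    rw [← map_add]
    congr 1
    ext n
    exact map_add f (a n) (b n)
  commutes' c := by
    rw [← (mk ω).commutes c, ← (mk ω).commutes c]
    change mk ω (mapSeq f (algebraMap ℂ _ c)) = _
    congr 1
    ext n
    exact AlgHomClass.commutes f c
  map_star' x := by
    obtain ⟨a, rfl⟩ := mk_surjective ω x
    change mk ω (mapSeq f (star a)) = mk ω (star (mapSeq f a))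
    congr 1
    ext n
    exact map_star f (a n)

theorem map_mk (f : A →⋆ₐ[ℂ] B) (a : lp (fun _ : ℕ => A) ∞) :
    map ω f (mk ω a) = mk ω (mapSeq f a) := rfl

/-- The automorphism of `A_ω` induced by an automorphism of `A`. -/
def mapAut (e : A ≃⋆ₐ[ℂ] A) : Ultrapower ω A ≃⋆ₐ[ℂ] Ultrapower ω A :=
  StarAlgEquiv.ofStarAlgHom (map ω (e : A →⋆ₐ[ℂ] A)) (map ω (e.symm : A →⋆ₐ[ℂ] A))
    (by
      ext x
      obtain ⟨a, rfl⟩ := mk_surjective ω x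
      change mk ω _ = mk ω a
      congr 1
      ext n
      exact e.symm_apply_apply (a n))
    (by
      ext x
      obtain ⟨a, rfl⟩ := mk_surjective ω x
      change mk ω _ = mk ω a
      congr 1
      ext n
      exact e.apply_symm_apply (a n))

/-- The action `α_ω` on `A_ω` induced by an action `α` on `A`. -/
def action {G : Type*} [Group G] (α : G →* (A ≃⋆ₐ[ℂ] A)) :
    G →* (Ultrapower ω A ≃⋆ₐ[ℂ] Ultrapower ω A) where
  toFun g := mapAut ω (α g)
  map_one' := by
    ext x
    obtain ⟨a, rfl⟩ := mk_surjective ω x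
    change mk ω _ = mk ω a
    congr 1
    ext n
    change α 1 (a n) = a n
    rw [map_one]; rfl
  map_mul' g h := by
    ext x
    obtain ⟨a, rfl⟩ := mk_surjective ω x
    change mk ω _ = mk ω _
    congr 1
    ext n
    change α (g * h) (a n) = α g (α h (a n))
    rw [map_mul]; rfl

theorem action_mk {G : Type*} [Group G] (α : G →* (A ≃⋆ₐ[ℂ] A)) (g : G)
    (a : lp (fun _ : ℕ => A) ∞) :
    action ω α g (mk ω a) = mk ω (mapSeq (α g : A →⋆ₐ[ℂ] A) a) := rfl

end Ultrapower

end Ultrapower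

/-! ### Simplicity, Cuntz subequivalence, order zero maps -/

/-- A unital C⋆-algebra is simple if it is nonzero and its only closed two-sided ideals are the
two trivial ones. -/
structure IsSimpleCStarAlgebra (A : Type*) [CStarAlgebra A] : Prop where
  nontrivial : Nontrivial A
  eq_bot_or_eq_top (I : TwoSidedIdeal A) (hI : IsClosed (I : Set A)) : I = ⊥ ∨ I = ⊤

/-- Cuntz subequivalence `a ≲ b` (for positive elements `a`, `b`). -/
def CuntzSubequiv {A : Type*} [CStarAlgebra A] (a b : A) : Prop :=
  ∃ x : ℕ → A, Tendsto (fun n => ‖x n * b * star (x n) - a‖) atTop (𝓝 0)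

/-- A completely positive map has order zero if it preserves orthogonality of positive
elements. -/
def IsOrderZero {A B : Type*} [CStarAlgebra A] [PartialOrder A] [StarOrderedRing A]
    [CStarAlgebra B] [PartialOrder B] [StarOrderedRing B] (ψ : A →CP B) : Prop :=
  ∀ a b : A, 0 ≤ a → 0 ≤ b → a * b = 0 → b * a = 0 → ψ a * ψ b = 0 ∧ ψ b * ψ a = 0

/-! ### Equivariant homomorphisms -/

/-- An equivariant ⋆-homomorphism `(A, α) → (B, β)` (not required to be unital). -/
structure EquivariantStarHom {G A B : Type*} [Group G] [CStarAlgebra A] [CStarAlgebra B]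
    (α : G →* (A ≃⋆ₐ[ℂ] A)) (β : G →* (B ≃⋆ₐ[ℂ] B)) where
  /-- The underlying ⋆-homomorphism. -/
  toHom : A →⋆ₙₐ[ℂ] B
  equivariant : ∀ (g : G) (a : A), toHom (α g a) = β g (toHom a)

/-- An equivariant ⋆-homomorphism `φ : (A, α) → (B, β)` is `G`-tracially sequentially-split by
order zero: for every nonzero positive `x` in `A_ω` there are an equivariant completely positive
order zero map `ψ : (B, β) → (A_ω, α_ω)` and a positive `e` in `A_ω ∩ A'` such that
`ψ (φ a) = a e = e a` for all `a` in `A`, and `1 - e ≲ x`. -/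
def IsTraciallySeqSplitOrderZero (ω : Ultrafilter ℕ) {G A B : Type*} [Group G]
    [CStarAlgebra A] [Nontrivial A]
    [CStarAlgebra B] [PartialOrder B] [StarOrderedRing B]
    {α : G →* (A ≃⋆ₐ[ℂ] A)} {β : G →* (B ≃⋆ₐ[ℂ] B)} (φ : EquivariantStarHom α β) : Prop :=
  ∀ x : Ultrapower ω A, 0 ≤ x → x ≠ 0 →
    ∃ (ψ : B →CP Ultrapower ω A) (e : Ultrapower ω A),
      IsOrderZero ψ ∧
      (∀ (g : G) (b : B), ψ (β g b) = Ultrapower.action ω α g (ψ b)) ∧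
      0 ≤ e ∧
      (∀ a : A, Ultrapower.diag ω A a * e = e * Ultrapower.diag ω A a) ∧
      (∀ a : A, ψ (φ.toHom a) = Ultrapower.diag ω A a * e) ∧
      CuntzSubequiv (1 - e) x

/-! ### Tensoring with `M_n`

`A ⊗ M_n` is the C⋆-algebra `M_n(A)` of matrices over `A`; the elementary tensor `a ⊗ x` is the
matrix with entries `x i j • a`. -/

section Matrix

variable {n : ℕ}

/-- The elementary tensor `a ⊗ x` in `A ⊗ M_n = M_n(A)`. -/
def elemTensor {A : Type*} [CStarAlgebra A] (a : A) (x : Matrix (Fin n) (Fin n) ℂ) :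
    CStarMatrix (Fin n) (Fin n) A :=
  CStarMatrix.ofMatrix fun i j => x i j • a

variable {A B : Type*} [CStarAlgebra A] [CStarAlgebra B]

theorem elemTensor_apply (a : A) (x : Matrix (Fin n) (Fin n) ℂ) (i j : Fin n) :
    elemTensor a x i j = x i j • a := rfl

theorem elemTensor_add (a b : A) (x : Matrix (Fin n) (Fin n) ℂ) :
    elemTensor (a + b) x = elemTensor a x + elemTensor b x := by
  ext i j
  simp [elemTensor_apply]

theorem elemTensor_smul (c : ℂ) (a : A) (x : Matrix (Fin n) (Fin n) ℂ) :
    elemTensor (c • a) x = c • elemTensor a x := by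
  ext i j
  simp [elemTensor_apply, smul_comm c]

theorem elemTensor_mul (a b : A) (x y : Matrix (Fin n) (Fin n) ℂ) :
    elemTensor a x * elemTensor b y = elemTensor (a * b) (x * y) := by
  ext i j
  simp only [CStarMatrix.mul_apply, elemTensor_apply, Matrix.mul_apply, Finset.sum_smul,
    smul_mul_smul_comm]

theorem star_elemTensor (a : A) (x : Matrix (Fin n) (Fin n) ℂ) :
    star (elemTensor a x) = elemTensor (star a) (star x) := by
  ext i j
  simp [CStarMatrix.star_apply, elemTensor_apply, Matrix.star_apply]

theorem sum_matrix_apply {ι : Type*} (s : Finset ι) (f : ι → CStarMatrix (Fin n) (Fin n) A)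
    (i j : Fin n) : (∑ k ∈ s, f k) i j = ∑ k ∈ s, f k i j := by
  classical
  induction s using Finset.induction_on with
  | empty => simp
  | insert k s hk ih => rw [Finset.sum_insert hk, Finset.sum_insert hk, CStarMatrix.add_apply, ih]

/-- The entries of a matrix give its expansion `M = ∑ i j, M i j ⊗ e_ij`. -/
theorem eq_sum_elemTensor (M : CStarMatrix (Fin n) (Fin n) A) :
    M = ∑ i, ∑ j, elemTensor (M i j) (Matrix.single i j 1) := by
  ext k l
  simp only [sum_matrix_apply, elemTensor_apply, Matrix.single_apply, ite_smul, one_smul,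
    zero_smul]
  rw [Finset.sum_eq_single k, Finset.sum_eq_single l] <;> simp +contextual

/-- The linear map `f ⊗ r` on `M_n(A)`. -/
def tensorFun (f : A ≃⋆ₐ[ℂ] A) (r : Matrix (Fin n) (Fin n) ℂ ≃⋆ₐ[ℂ] Matrix (Fin n) (Fin n) ℂ) :
    CStarMatrix (Fin n) (Fin n) A →ₗ[ℂ] CStarMatrix (Fin n) (Fin n) A where
  toFun M := ∑ i, ∑ j, elemTensor (f (M i j)) (r (Matrix.single i j 1))
  map_add' M N := by
    simp only [CStarMatrix.add_apply, map_add, elemTensor_add, Finset.sum_add_distrib]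
  map_smul' c M := by
    simp only [CStarMatrix.smul_apply, map_smul, elemTensor_smul, Finset.smul_sum,
      RingHom.id_apply]

/-- `f ⊗ r` sends `a ⊗ x` to `f a ⊗ r x`. -/
theorem tensorFun_elemTensor (f : A ≃⋆ₐ[ℂ] A)
    (r : Matrix (Fin n) (Fin n) ℂ ≃⋆ₐ[ℂ] Matrix (Fin n) (Fin n) ℂ)
    (a : A) (x : Matrix (Fin n) (Fin n) ℂ) :
    tensorFun f r (elemTensor a x) = elemTensor (f a) (r x) := by
  have hx : r x = ∑ i, ∑ j, x i j • r (Matrix.single i j 1) := by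
    conv_lhs => rw [Matrix.matrix_eq_sum_single x]
    simp only [map_sum]
    refine Finset.sum_congr rfl fun i _ => Finset.sum_congr rfl fun j _ => ?_
    rw [← map_smul, Matrix.smul_single, smul_eq_mul, mul_one]
  change ∑ i, ∑ j, elemTensor (f (elemTensor a x i j)) (r (Matrix.single i j 1)) = _
  rw [hx]
  ext k l
  simp only [sum_matrix_apply, elemTensor_apply, map_smul, Matrix.sum_apply, Matrix.smul_apply,
    Finset.sum_smul, smul_eq_mul, mul_smul]
  exact Finset.sum_congr rfl fun i _ => Finset.sum_congr rfl fun j _ => smul_comm _ _ _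

/-- Two additive maps on `M_n(A)` which agree on elementary tensors are equal. -/
theorem eq_of_eq_elemTensor {D : Type*} [AddCommMonoid D]
    (S T : CStarMatrix (Fin n) (Fin n) A →+ D)
    (h : ∀ a x, S (elemTensor a x) = T (elemTensor a x)) (M : CStarMatrix (Fin n) (Fin n) A) :
    S M = T M := by
  rw [eq_sum_elemTensor M]
  simp only [map_sum, h]

theorem tensorFun_mul (f : A ≃⋆ₐ[ℂ] A)
    (r : Matrix (Fin n) (Fin n) ℂ ≃⋆ₐ[ℂ] Matrix (Fin n) (Fin n) ℂ)
    (M N : CStarMatrix (Fin n) (Fin n) A) :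
    tensorFun f r (M * N) = tensorFun f r M * tensorFun f r N := by
  have h1 : ∀ a x, tensorFun f r (elemTensor a x * N) =
      tensorFun f r (elemTensor a x) * tensorFun f r N := fun a x =>
    eq_of_eq_elemTensor
      ((tensorFun f r).toAddMonoidHom.comp (AddMonoidHom.mulLeft (elemTensor a x)))
      ((AddMonoidHom.mulLeft (tensorFun f r (elemTensor a x))).comp
        (tensorFun f r).toAddMonoidHom)
      (fun b y => by
        change tensorFun f r (elemTensor a x * elemTensor b y) =
          tensorFun f r (elemTensor a x) * tensorFun f r (elemTensor b y)
        simp only [elemTensor_mul, tensorFun_elemTensor, map_mul]) N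
  exact eq_of_eq_elemTensor
    ((tensorFun f r).toAddMonoidHom.comp (AddMonoidHom.mulRight N))
    ((AddMonoidHom.mulRight (tensorFun f r N)).comp (tensorFun f r).toAddMonoidHom) h1 M

theorem tensorFun_star (f : A ≃⋆ₐ[ℂ] A)
    (r : Matrix (Fin n) (Fin n) ℂ ≃⋆ₐ[ℂ] Matrix (Fin n) (Fin n) ℂ)
    (M : CStarMatrix (Fin n) (Fin n) A) :
    tensorFun f r (star M) = star (tensorFun f r M) :=
  eq_of_eq_elemTensor
    ((tensorFun f r).toAddMonoidHom.comp (starAddEquiv (R := CStarMatrix (Fin n) (Fin n) A) :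
      CStarMatrix (Fin n) (Fin n) A →+ CStarMatrix (Fin n) (Fin n) A))
    ((starAddEquiv (R := CStarMatrix (Fin n) (Fin n) A) :
      CStarMatrix (Fin n) (Fin n) A →+ CStarMatrix (Fin n) (Fin n) A).comp
        (tensorFun f r).toAddMonoidHom)
    (fun a x => by
      change tensorFun f r (star (elemTensor a x)) = star (tensorFun f r (elemTensor a x))
      simp only [star_elemTensor, tensorFun_elemTensor, map_star]) M

theorem tensorFun_comp (f f' : A ≃⋆ₐ[ℂ] A)
    (r r' : Matrix (Fin n) (Fin n) ℂ ≃⋆ₐ[ℂ] Matrix (Fin n) (Fin n) ℂ)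
    (M : CStarMatrix (Fin n) (Fin n) A) :
    tensorFun f r (tensorFun f' r' M) = tensorFun (f * f') (r * r') M :=
  eq_of_eq_elemTensor
    ((tensorFun f r).toAddMonoidHom.comp (tensorFun f' r').toAddMonoidHom)
    (tensorFun (f * f') (r * r')).toAddMonoidHom
    (fun a x => by
      change tensorFun f r (tensorFun f' r' (elemTensor a x)) =
        tensorFun (f * f') (r * r') (elemTensor a x)
      simp only [tensorFun_elemTensor]; rfl) M

theorem tensorFun_one (M : CStarMatrix (Fin n) (Fin n) A) :
    tensorFun (1 : A ≃⋆ₐ[ℂ] A)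
      (1 : Matrix (Fin n) (Fin n) ℂ ≃⋆ₐ[ℂ] Matrix (Fin n) (Fin n) ℂ) M = M :=
  eq_of_eq_elemTensor (tensorFun 1 1).toAddMonoidHom (AddMonoidHom.id _)
    (fun a x => tensorFun_elemTensor 1 1 a x) M

/-- The automorphism `f ⊗ r` of `A ⊗ M_n`. -/
def tensorAut (f : A ≃⋆ₐ[ℂ] A)
    (r : Matrix (Fin n) (Fin n) ℂ ≃⋆ₐ[ℂ] Matrix (Fin n) (Fin n) ℂ) :
    CStarMatrix (Fin n) (Fin n) A ≃⋆ₐ[ℂ] CStarMatrix (Fin n) (Fin n) A where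
  toFun := tensorFun f r
  invFun := tensorFun f⁻¹ r⁻¹
  left_inv M := by rw [tensorFun_comp, inv_mul_cancel, inv_mul_cancel, tensorFun_one]
  right_inv M := by rw [tensorFun_comp, mul_inv_cancel, mul_inv_cancel, tensorFun_one]
  map_mul' := tensorFun_mul f r
  map_add' := map_add (tensorFun f r)
  map_star' := tensorFun_star f r
  map_smul' := map_smul (tensorFun f r)

theorem tensorAut_elemTensor (f : A ≃⋆ₐ[ℂ] A)
    (r : Matrix (Fin n) (Fin n) ℂ ≃⋆ₐ[ℂ] Matrix (Fin n) (Fin n) ℂ)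
    (a : A) (x : Matrix (Fin n) (Fin n) ℂ) :
    tensorAut f r (elemTensor a x) = elemTensor (f a) (r x) := tensorFun_elemTensor f r a x

variable {G : Type*} [Group G]

/-- The action `α ⊗ ρ` on `A ⊗ M_n`. -/
def tensorAction (α : G →* (A ≃⋆ₐ[ℂ] A))
    (ρ : G →* (Matrix (Fin n) (Fin n) ℂ ≃⋆ₐ[ℂ] Matrix (Fin n) (Fin n) ℂ)) :
    G →* (CStarMatrix (Fin n) (Fin n) A ≃⋆ₐ[ℂ] CStarMatrix (Fin n) (Fin n) A) where
  toFun g := tensorAut (α g) (ρ g)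
  map_one' := by
    ext1 M
    rw [map_one, map_one]
    exact tensorFun_one M
  map_mul' g h := by
    ext1 M
    rw [map_mul, map_mul]
    exact (tensorFun_comp (α g) (α h) (ρ g) (ρ h) M).symm

theorem tensorAction_elemTensor (α : G →* (A ≃⋆ₐ[ℂ] A))
    (ρ : G →* (Matrix (Fin n) (Fin n) ℂ ≃⋆ₐ[ℂ] Matrix (Fin n) (Fin n) ℂ)) (g : G)
    (a : A) (x : Matrix (Fin n) (Fin n) ℂ) :
    tensorAction α ρ g (elemTensor a x) = elemTensor (α g a) (ρ g x) :=
  tensorFun_elemTensor (α g) (ρ g) a x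

theorem mapₙₐ_elemTensor (φ : A →⋆ₙₐ[ℂ] B) (a : A) (x : Matrix (Fin n) (Fin n) ℂ) :
    CStarMatrix.mapₙₐ φ (elemTensor a x) = elemTensor (φ a) x := by
  ext i j
  exact map_smul φ (x i j) a

variable [PartialOrder A] [StarOrderedRing A] [PartialOrder B] [StarOrderedRing B]

/-- The equivariant ⋆-homomorphism `φ ⊗ id : (A ⊗ M_n, α ⊗ ρ) → (B ⊗ M_n, β ⊗ ρ)`, given by
applying `φ` to every entry. -/
def EquivariantStarHom.tensorMatrix {α : G →* (A ≃⋆ₐ[ℂ] A)} {β : G →* (B ≃⋆ₐ[ℂ] B)}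
    (φ : EquivariantStarHom α β)
    (ρ : G →* (Matrix (Fin n) (Fin n) ℂ ≃⋆ₐ[ℂ] Matrix (Fin n) (Fin n) ℂ)) :
    EquivariantStarHom (tensorAction α ρ) (tensorAction β ρ) where
  toHom := CStarMatrix.mapₙₐ φ.toHom
  equivariant g M := by
    let Φ : CStarMatrix (Fin n) (Fin n) A →+ CStarMatrix (Fin n) (Fin n) B :=
      AddMonoidHomClass.toAddMonoidHom
        (CStarMatrix.mapₙₐ φ.toHom :
          CStarMatrix (Fin n) (Fin n) A →⋆ₙₐ[ℂ] CStarMatrix (Fin n) (Fin n) B)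
    have hΦ : ∀ a x, Φ (elemTensor a x) = elemTensor (φ.toHom a) x :=
      mapₙₐ_elemTensor φ.toHom
    exact eq_of_eq_elemTensor (Φ.comp (tensorFun (α g) (ρ g)).toAddMonoidHom)
      ((tensorFun (β g) (ρ g)).toAddMonoidHom.comp Φ)
      (fun a x => by
        change Φ (tensorFun (α g) (ρ g) (elemTensor a x)) =
          tensorFun (β g) (ρ g) (Φ (elemTensor a x))
        rw [tensorFun_elemTensor, hΦ, hΦ, tensorFun_elemTensor, φ.equivariant]) M

end Matrix

end

/-! ### Banded sums -/

section Banded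

/-! Passing from `φ` to `φ ⊗ id` is amplification: `ψ ⊗ id` with `e ⊗ 1`. Given a nonzero positive
`X` in `M_n(A_ω)`, some diagonal entry `X i i` is nonzero. Since `A` is simple and
infinite-dimensional, this entry dominates `n` orthogonal copies of one nonzero positive `y`. If `1
- e ≲ y`, these copies absorb the `n` diagonal blocks of `(1 - e) ⊗ 1`, so `1 - e ⊗ 1 ≲ X`.

For the converse with `φ` unital, test on `x ⊗ e₀₀`. The element `E` commutes with `1 ⊗ M_n`, hence
is `e ⊗ 1`. Also `Ψ (1 ⊗ m) = (1 ⊗ m) E` with `E = Ψ 1`, which forces `Ψ (B ⊗ 1)` to commute with `1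
⊗ M_n`. So `Ψ (b ⊗ 1) = ψ b ⊗ 1`, and `ψ` is equivariant whatever `ρ` is, because every `ρ g` fixes
`1`.

If `φ` is not unital, nothing ties `Ψ` to `1 ⊗ M_n`, but the condition degenerates. The projection
`p = φ 1` has a nonzero complement, which is full because `B` is simple. As `Ψ (p ⊗ 1) = E` and `Ψ`
has order zero, `1 - E` is full, with a number of terms that depends only on `φ`. Testing on a small
enough element below `x` gives `1 ≲ x` for every nonzero positive `x`. Then the zero map and `e = 0`
satisfy the definition.

Both directions rest on the identity `ψ x * ψ y = ψ (x * y) * ψ 1` for order zero maps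
(`IsOrderZero.map_mul_map`). It is obtained by cutting a positive contraction into hat functions,
whose images are almost orthogonal, and by a null vector argument for positive matrices. The other
ingredient is `Ultrapower.exists_orthogonal_copies`. -/

theorem card_filter_near_le (s : Finset ℕ) (i : ℕ) :
    (s.filter fun j => ¬ (i + 2 ≤ j ∨ j + 2 ≤ i)).card ≤ 3 := by
  have h : (s.filter fun j => ¬ (i + 2 ≤ j ∨ j + 2 ≤ i)) ⊆ {i - 1, i, i + 1} := by
    intro j hj
    simp only [Finset.mem_filter, Finset.mem_insert, Finset.mem_singleton] at hj ⊢
    omega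
  exact (Finset.card_le_card h).trans Finset.card_le_three

theorem norm_sum_banded_le {D : Type*} [SeminormedAddCommGroup D] (s : Finset ℕ) (i : ℕ)
    (F : ℕ → D) {M : ℝ} (hM0 : 0 ≤ M) (hM : ∀ j ∈ s, ‖F j‖ ≤ M) (hF : ∀ j, i + 2 ≤ j ∨ j + 2 ≤ i → F j = 0) :
    ‖∑ j ∈ s, F j‖ ≤ 3 * M := by
  rw [← Finset.sum_filter_of_ne (p := fun j => ¬ (i + 2 ≤ j ∨ j + 2 ≤ i))
    fun j _ hj h => hj (hF j h)]
  refine (norm_sum_le_of_le _ fun j hj => hM j (Finset.mem_filter.1 hj).1).trans ?_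
  rw [Finset.sum_const, nsmul_eq_mul]
  gcongr
  exact_mod_cast card_filter_near_le s i

variable {D : Type*} [CStarAlgebra D]

/-- If the self-adjoint `E i` are orthogonal at distance at least two, then a weighted sum of
their products grows at most like the square root of the number of terms. -/
theorem norm_sum_sq_le_of_banded (s : Finset ℕ) (E : ℕ → D) (hE : ∀ i, star (E i) = E i)
    (horth : ∀ i j, i + 2 ≤ j ∨ j + 2 ≤ i → E i * E j = 0) {M K : ℝ} (hM0 : 0 ≤ M)
    (hM : ∀ i ∈ s, ‖E i‖ ≤ M)
    (c : ℕ → ℕ → ℝ) (hK : 0 ≤ K) (hc : ∀ i j, ¬ (i + 2 ≤ j ∨ j + 2 ≤ i) → |c i j| ≤ K) :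
    ‖∑ i ∈ s, ∑ j ∈ s, c i j • (E i * E j)‖ ^ 2 ≤ s.card * (3 * (3 * (K * M ^ 2)) ^ 2) := by
  set X : ℕ → D := fun i => ∑ j ∈ s, c i j • E j with hX
  have hterm : ∀ i ∈ s, ∀ j ∈ s, ‖c i j • (E i * E j)‖ ≤ K * M ^ 2 := by
    intro i his j hjs
    by_cases h : i + 2 ≤ j ∨ j + 2 ≤ i
    · rw [horth i j h, smul_zero, norm_zero]; positivity
    · rw [norm_smul, Real.norm_eq_abs, sq]
      exact mul_le_mul (hc i j h) ((norm_mul_le _ _).trans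
        (mul_le_mul (hM i his) (hM j hjs) (norm_nonneg _) hM0)) (norm_nonneg _) hK
  have hEX : ∀ i, E i * X i = ∑ j ∈ s, c i j • (E i * E j) := fun i => by
    simp only [hX, Finset.mul_sum, mul_smul_comm]
  have hrow : ∀ i ∈ s, ‖E i * X i‖ ≤ 3 * (K * M ^ 2) := fun i hi => by
    rw [hEX]
    exact norm_sum_banded_le s i _ (by positivity) (hterm i hi) fun j hj => by rw [horth i j hj, smul_zero]
  -- The triangle inequality over rows would give a bound linear in the number of terms. After
  -- passing to `S* S` the rows are themselves almost orthogonal, so only three blocks per row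
  -- survive and the linear bound holds for the square of the norm.
  have hstar : ‖∑ i ∈ s, ∑ j ∈ s, c i j • (E i * E j)‖ ^ 2 =
      ‖∑ i ∈ s, ∑ k ∈ s, star (E i * X i) * (E k * X k)‖ := by
    simp only [← hEX]
    rw [sq, ← CStarRing.norm_star_mul_self, star_sum, Finset.sum_mul_sum]
  rw [hstar]
  have hrow2 : ∀ i ∈ s, ‖∑ k ∈ s, star (E i * X i) * (E k * X k)‖ ≤
      3 * (3 * (K * M ^ 2)) ^ 2 := fun i hi => by
    refine norm_sum_banded_le s i _ (by positivity) (fun k hk => ?_) fun k hk => ?_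
    · refine (norm_mul_le _ _).trans ?_
      rw [norm_star, sq]
      exact mul_le_mul (hrow i hi) (hrow k hk) (norm_nonneg _) (by positivity)
    · rw [star_mul, hE, mul_assoc, ← mul_assoc (E i), horth i k hk, zero_mul, mul_zero]
  refine (norm_sum_le_of_le _ hrow2).trans ?_
  rw [Finset.sum_const, nsmul_eq_mul]

end Banded

/-! ### Hat functions -/

section Hat

/-- The hat function of height one and radius `1 / N` around `i / N`. -/
noncomputable def hat (N i : ℕ) (t : ℝ) : ℝ := max 0 (1 - |N * t - i|)

theorem hat_nonneg (N i : ℕ) (t : ℝ) : 0 ≤ hat N i t := le_max_left _ _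

@[fun_prop]
theorem continuous_hat (N i : ℕ) : Continuous (hat N i) := by unfold hat; fun_prop

theorem hat_mul_hat_eq_zero (N : ℕ) {i j : ℕ} (h : i + 2 ≤ j ∨ j + 2 ≤ i) (t : ℝ) :
    hat N i t * hat N j t = 0 := by
  by_contra hne
  obtain ⟨hi, hj⟩ := mul_ne_zero_iff.1 hne
  have key : ∀ k, hat N k t ≠ 0 → |N * t - k| < 1 := fun k hk => by
    by_contra h1
    exact hk (max_eq_left (by linarith))
  have hi := abs_lt.1 (key i hi)
  have hj := abs_lt.1 (key j hj)
  rcases h with h | h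
  · have : (i : ℝ) + 2 ≤ j := by exact_mod_cast h
    linarith [hi.1, hi.2, hj.1, hj.2]
  · have : (j : ℝ) + 2 ≤ i := by exact_mod_cast h
    linarith [hi.1, hi.2, hj.1, hj.2]

/-- A hat is a second difference of the ramp `max 0`, so sums of hats telescope and sums weighted by
`i` are found by summation by parts. -/
theorem hat_eq_ramp (N i : ℕ) (t : ℝ) :
    hat N i t = (max 0 (N * t - i + 1) - max 0 (N * t - i)) -
      (max 0 (N * t - i) - max 0 (N * t - i - 1)) := by
  unfold hat
  generalize (N : ℝ) * t - i = u
  rcases le_total 0 u with h | h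
  · rw [abs_of_nonneg h, max_eq_right h, max_eq_right (by linarith : 0 ≤ u + 1)]
    rcases le_total u 1 with h1 | h1
    · rw [max_eq_right (by linarith : (0 : ℝ) ≤ 1 - u), max_eq_left (by linarith : u - 1 ≤ 0)]
      ring
    · rw [max_eq_left (by linarith : 1 - u ≤ (0 : ℝ)), max_eq_right (by linarith : 0 ≤ u - 1)]
      ring
  · rw [abs_of_nonpos h, max_eq_left h, max_eq_left (by linarith : u - 1 ≤ 0)]
    simp [add_comm]

theorem sum_hat_range (N m : ℕ) (t : ℝ) :
    ∑ i ∈ Finset.range m, hat N i t = (max 0 (N * t + 1) - max 0 (N * t)) -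
      (max 0 (N * t - m + 1) - max 0 (N * t - m)) := by
  induction m with
  | zero => simp
  | succ m ih =>
    rw [Finset.sum_range_succ, ih, hat_eq_ramp]
    push_cast
    rw [show (N : ℝ) * t - (m + 1) + 1 = N * t - m by ring,
      show (N : ℝ) * t - (m + 1) = N * t - m - 1 by ring]
    ring

theorem sum_mul_hat_range (N m : ℕ) (t : ℝ) :
    ∑ i ∈ Finset.range m, (i : ℝ) * hat N i t = max 0 (N * t) - max 0 (N * t - m + 1) -
      (m - 1) * (max 0 (N * t - m + 1) - max 0 (N * t - m)) := by
  induction m with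
  | zero => simp
  | succ m ih =>
    rw [Finset.sum_range_succ, ih, hat_eq_ramp]
    push_cast
    rw [show (N : ℝ) * t - (m + 1) + 1 = N * t - m by ring,
      show (N : ℝ) * t - (m + 1) = N * t - m - 1 by ring]
    ring

variable {N : ℕ} {t : ℝ}

theorem sum_hat (ht : t ∈ Set.Icc (0 : ℝ) 1) : ∑ i ∈ Finset.range (N + 1), hat N i t = 1 := by
  have h0 : 0 ≤ (N : ℝ) * t := mul_nonneg N.cast_nonneg ht.1
  have h1 : (N : ℝ) * t ≤ N := mul_le_of_le_one_right N.cast_nonneg ht.2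
  rw [sum_hat_range]
  push_cast
  rw [max_eq_right (by linarith), max_eq_right h0, max_eq_left (by linarith),
    max_eq_left (by linarith)]
  ring

theorem sum_mul_hat (ht : t ∈ Set.Icc (0 : ℝ) 1) :
    ∑ i ∈ Finset.range (N + 1), (i : ℝ) * hat N i t = N * t := by
  have h0 : 0 ≤ (N : ℝ) * t := mul_nonneg N.cast_nonneg ht.1
  have h1 : (N : ℝ) * t ≤ N := mul_le_of_le_one_right N.cast_nonneg ht.2
  rw [sum_mul_hat_range]
  push_cast
  rw [max_eq_right h0, max_eq_left (by linarith : (N : ℝ) * t - (N + 1) + 1 ≤ 0),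
    max_eq_left (by linarith : (N : ℝ) * t - (N + 1) ≤ 0)]
  ring

/-- The hats at `t` are weights of total mass one and mean `t` on the nodes `i / N`, so the
difference is their variance. Only nodes within `1 / N` of `t` carry mass. -/
theorem abs_sum_sq_mul_hat_sub_le (hN : 0 < N) (ht : t ∈ Set.Icc (0 : ℝ) 1) :
    |∑ i ∈ Finset.range (N + 1), ((i : ℝ) / N) ^ 2 * hat N i t - t ^ 2| ≤ 1 / N := by
  have hN' : (0 : ℝ) < N := by exact_mod_cast hN
  have hN1 : (1 : ℝ) ≤ N := by exact_mod_cast hN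
  have h1 : ∑ i ∈ Finset.range (N + 1), ((i : ℝ) / N) ^ 2 * hat N i t - t ^ 2 =
      ∑ i ∈ Finset.range (N + 1), ((i : ℝ) / N - t) ^ 2 * hat N i t := by
    have h2 : ∀ i : ℕ, ((i : ℝ) / N - t) ^ 2 * hat N i t =
        ((i : ℝ) / N) ^ 2 * hat N i t - 2 * t / N * ((i : ℝ) * hat N i t) +
          t ^ 2 * hat N i t := fun i => by field_simp; ring
    simp only [h2, Finset.sum_add_distrib, Finset.sum_sub_distrib, ← Finset.mul_sum,
      sum_hat ht, sum_mul_hat ht]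
    field_simp
    ring
  have h3 : ∀ i : ℕ, ((i : ℝ) / N - t) ^ 2 * hat N i t ≤ 1 / N * hat N i t := fun i => by
    by_cases h : hat N i t = 0
    · simp [h]
    refine mul_le_mul_of_nonneg_right ?_ (hat_nonneg N i t)
    have h4 : |N * t - i| < 1 := by
      by_contra h1
      exact h (max_eq_left (by linarith))
    have h5 : (i : ℝ) / N - t = -(N * t - i) / N := by field_simp; ring
    rw [h5, div_pow, neg_sq, ← sq_abs, div_le_div_iff₀ (by positivity) hN']
    have h6 : |N * t - i| ^ 2 ≤ 1 := pow_le_one₀ (abs_nonneg _) h4.le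
    nlinarith
  rw [h1, abs_of_nonneg (Finset.sum_nonneg fun i _ =>
    mul_nonneg (sq_nonneg _) (hat_nonneg N i t))]
  refine (Finset.sum_le_sum fun i _ => h3 i).trans ?_
  rw [← Finset.mul_sum, sum_hat ht, mul_one]

end Hat

/-! ### Structure of order zero maps -/

section OrderZero

variable {B D : Type*} [CStarAlgebra B] [PartialOrder B] [StarOrderedRing B]
  [CStarAlgebra D] [PartialOrder D] [StarOrderedRing D]

theorem CompletelyPositiveMap.map_nonneg' (ψ : B →CP D) {b : B} (hb : 0 ≤ b) : 0 ≤ ψ b :=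
  map_nonneg ψ hb

theorem CompletelyPositiveMap.map_star' (ψ : B →CP D) (b : B) : ψ (star b) = star (ψ b) := by
  have h := CStarAlgebra.span_nonneg (A := B)
  have hb : b ∈ Submodule.span ℂ {a : B | 0 ≤ a} := h ▸ Submodule.mem_top
  induction hb using Submodule.span_induction with
  | mem x hx =>
    rw [(IsSelfAdjoint.of_nonneg hx).star_eq,
      (IsSelfAdjoint.of_nonneg (ψ.map_nonneg' hx)).star_eq]
  | zero => simp
  | add x y _ _ hx hy => simp [hx, hy]
  | smul c x _ hx => simp [hx, map_smul]

theorem CompletelyPositiveMap.map_real_smul (ψ : B →CP D) (r : ℝ) (b : B) :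
    ψ (r • b) = r • ψ b := by
  rw [← Complex.coe_smul, map_smul, Complex.coe_smul]

theorem spectrum_subset_Icc_of_norm_le_one {a : B} (ha : 0 ≤ a) (ha1 : ‖a‖ ≤ 1) :
    ∀ t ∈ spectrum ℝ a, t ∈ Set.Icc (0 : ℝ) 1 := fun t ht => by
  refine ⟨spectrum_nonneg_of_nonneg ha ht, ?_⟩
  rcases subsingleton_or_nontrivial B with h | h
  · simp [spectrum.of_subsingleton] at ht
  have := spectrum.norm_le_norm_of_mem ht
  exact (le_abs_self t).trans (this.trans ha1)

/-- The images of the hat functions of a positive contraction under an order zero map. -/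
noncomputable def hatImage (ψ : B →CP D) (a : B) (N i : ℕ) : D := ψ (cfc (hat N i) a)

variable (ψ : B →CP D) {a : B} (ha : 0 ≤ a) (ha1 : ‖a‖ ≤ 1)

theorem hatImage_nonneg (N i : ℕ) : 0 ≤ hatImage ψ a N i :=
  ψ.map_nonneg' (cfc_nonneg fun t _ => hat_nonneg N i t)

theorem hatImage_mul_eq_zero (hψ : IsOrderZero ψ) (N : ℕ) {i j : ℕ}
    (h : i + 2 ≤ j ∨ j + 2 ≤ i) : hatImage ψ a N i * hatImage ψ a N j = 0 := by
  have hz : ∀ i j, (i + 2 ≤ j ∨ j + 2 ≤ i) → cfc (hat N i) a * cfc (hat N j) a = 0 := by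
    intro i j h
    rw [← cfc_mul _ _ a]
    simp only [hat_mul_hat_eq_zero N h]
    exact cfc_const_zero ℝ a
  exact (hψ _ _ (cfc_nonneg fun t _ => hat_nonneg N i t)
    (cfc_nonneg fun t _ => hat_nonneg N j t) (hz i j h) (hz j i h.symm)).1

theorem sum_smul_hatImage (N : ℕ) (c : ℕ → ℝ) :
    ∑ i ∈ Finset.range (N + 1), c i • hatImage ψ a N i =
      ψ (cfc (fun t => ∑ i ∈ Finset.range (N + 1), c i * hat N i t) a) := by
  have hs : cfc (fun t => ∑ i ∈ Finset.range (N + 1), c i * hat N i t) a =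
      ∑ i ∈ Finset.range (N + 1), cfc (fun t => c i * hat N i t) a := by
    rw [← cfc_sum (fun i t => c i * hat N i t) a]
    congr 1
    ext t
    simp
  rw [hs, map_sum]
  simp only [hatImage]
  refine Finset.sum_congr rfl fun i _ => ?_
  rw [cfc_const_mul (c i) (hat N i) a, ψ.map_real_smul]

include ha ha1

theorem sum_hatImage (N : ℕ) : ∑ i ∈ Finset.range (N + 1), hatImage ψ a N i = ψ 1 := by
  have h := sum_smul_hatImage ψ (a := a) N fun _ => 1
  simp only [one_smul, one_mul] at h
  rw [h, ← cfc_const_one ℝ a]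
  congr 1
  exact cfc_congr fun t ht => sum_hat (spectrum_subset_Icc_of_norm_le_one ha ha1 t ht)

/-- Positive summands lie below their sum `ψ 1`; the point is that the bound does not depend on `N`.
-/
theorem norm_hatImage_le {N i : ℕ} (hi : i ∈ Finset.range (N + 1)) :
    ‖hatImage ψ a N i‖ ≤ ‖ψ 1‖ := by
  refine CStarAlgebra.norm_le_norm_of_nonneg_of_le (hatImage_nonneg ψ N i) ?_
  rw [← sum_hatImage ψ ha ha1 N]
  exact Finset.single_le_sum (f := fun i => hatImage ψ a N i)
    (fun i _ => hatImage_nonneg ψ N i) hi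

theorem sum_div_smul_hatImage {N : ℕ} (hN : 0 < N) :
    ∑ i ∈ Finset.range (N + 1), ((i : ℝ) / N) • hatImage ψ a N i = ψ a := by
  have hN' : (N : ℝ) ≠ 0 := by exact_mod_cast hN.ne'
  rw [sum_smul_hatImage ψ N]
  congr 1
  conv_rhs => rw [← cfc_id ℝ a]
  refine cfc_congr fun t ht => ?_
  have h := sum_mul_hat (N := N) (spectrum_subset_Icc_of_norm_le_one ha ha1 t ht)
  simp only [id]
  rw [← mul_right_inj' hN', ← h, Finset.mul_sum]
  exact Finset.sum_congr rfl fun i _ => by field_simp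

theorem tendsto_sum_div_sq_smul_hatImage :
    Tendsto (fun N : ℕ => ∑ i ∈ Finset.range (N + 1), ((i : ℝ) / N) ^ 2 • hatImage ψ a N i)
      atTop (𝓝 (ψ (a * a))) := by
  simp only [sum_smul_hatImage ψ]
  refine ((map_continuous ψ).tendsto _).comp (tendsto_iff_norm_sub_tendsto_zero.2 ?_)
  refine squeeze_zero' (g := fun N : ℕ => 1 / (N : ℝ)) (.of_forall fun N => norm_nonneg _) ?_
    tendsto_one_div_atTop_nhds_zero_nat
  filter_upwards [eventually_gt_atTop 0] with N hN
  have hsq : a * a = cfc (fun t : ℝ => t ^ 2) a := by rw [cfc_pow_id a, sq]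
  rw [hsq, ← cfc_sub _ _ a]
  exact norm_cfc_le (by positivity) fun t ht =>
    abs_sum_sq_mul_hat_sub_le hN (spectrum_subset_Icc_of_norm_le_one ha ha1 t ht)

/-- The banded estimate bounds the squared norm by a constant times `(N + 1) / N ^ 2`: there are `N
+ 1` rows and the coefficients have size at most `1 / N`. -/
theorem tendsto_norm_sum_hatImage_mul (hψ : IsOrderZero ψ) (c : ℕ → ℕ → ℕ → ℝ)
    (hc : ∀ N i j, ¬ (i + 2 ≤ j ∨ j + 2 ≤ i) → |c N i j| ≤ 1 / N) :
    Tendsto (fun N : ℕ => ∑ i ∈ Finset.range (N + 1), ∑ j ∈ Finset.range (N + 1),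
      c N i j • (hatImage ψ a N i * hatImage ψ a N j)) atTop (𝓝 0) := by
  have hlim : Tendsto (fun N : ℕ => 54 * ‖ψ 1‖ ^ 4 * (1 / (N : ℝ))) atTop (𝓝 0) := by
    simpa using (tendsto_one_div_atTop_nhds_zero_nat (𝕜 := ℝ)).const_mul (54 * ‖ψ 1‖ ^ 4)
  rw [tendsto_zero_iff_norm_tendsto_zero]
  have hsq : Tendsto (fun N : ℕ => ‖∑ i ∈ Finset.range (N + 1), ∑ j ∈ Finset.range (N + 1),
      c N i j • (hatImage ψ a N i * hatImage ψ a N j)‖ ^ 2) atTop (𝓝 0) := by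
    refine squeeze_zero' (.of_forall fun N => by positivity) ?_ hlim
    filter_upwards [eventually_gt_atTop 0] with N hN
    have hN' : (1 : ℝ) ≤ N := by exact_mod_cast hN
    refine (norm_sum_sq_le_of_banded (Finset.range (N + 1)) (hatImage ψ a N)
      (fun i => (IsSelfAdjoint.of_nonneg (hatImage_nonneg ψ N i)).star_eq)
      (fun i j h => hatImage_mul_eq_zero ψ hψ N h) (norm_nonneg (ψ 1))
      (fun i hi => norm_hatImage_le ψ ha ha1 hi) (c N) (by positivity) (hc N)).trans ?_
    rw [Finset.card_range]
    push_cast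
    have h1 : ((N : ℝ) + 1) * (3 * (3 * (1 / N * ‖ψ 1‖ ^ 2)) ^ 2) =
        27 * ‖ψ 1‖ ^ 4 * (1 / N) * (1 + 1 / N) := by field_simp; ring
    rw [h1, show 54 * ‖ψ 1‖ ^ 4 * (1 / (N : ℝ)) = 27 * ‖ψ 1‖ ^ 4 * (1 / N) * 2 by ring]
    have h2 : 1 / (N : ℝ) ≤ 1 := by rw [div_le_one (by linarith)]; exact hN'
    gcongr
    linarith
  simpa [Real.sqrt_sq] using hsq.sqrt

/-- With `h i` the image of the `i`-th hat, `ψ 1 = ∑ h i` and `ψ a = ∑ (i / N) h i`. Hence the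
commutator is `∑ ((j - i) / N) h i h j`, a banded sum with small coefficients, for every `N`. -/
theorem IsOrderZero.commute_one_of_contraction (hψ : IsOrderZero ψ) :
    ψ 1 * ψ a = ψ a * ψ 1 := by
  have h0 := tendsto_norm_sum_hatImage_mul ψ ha ha1 hψ (fun N i j => ((j : ℝ) - i) / N)
    fun N i j h => by
      rw [abs_div, Nat.abs_cast]
      gcongr
      push Not at h
      have h1 : (j : ℝ) < i + 2 := by exact_mod_cast h.1
      have h2 : (i : ℝ) < j + 2 := by exact_mod_cast h.2
      have h3 : j ≤ i + 1 := by omega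
      have h4 : i ≤ j + 1 := by omega
      have h5 : (j : ℝ) ≤ i + 1 := by exact_mod_cast h3
      have h6 : (i : ℝ) ≤ j + 1 := by exact_mod_cast h4
      rw [abs_le]
      constructor <;> linarith
  rw [← sub_eq_zero]
  refine tendsto_nhds_unique (tendsto_const_nhds.congr' ?_) h0
  filter_upwards [eventually_gt_atTop 0] with N hN
  rw [← sum_div_smul_hatImage ψ ha ha1 hN, ← sum_hatImage ψ ha ha1 N, Finset.sum_mul_sum,
    Finset.sum_mul_sum, ← Finset.sum_sub_distrib]
  refine Finset.sum_congr rfl fun i _ => ?_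
  rw [← Finset.sum_sub_distrib]
  refine Finset.sum_congr rfl fun j _ => ?_
  rw [mul_smul_comm, smul_mul_assoc, ← sub_smul, sub_div]

/-- Since `i² + j² - 2ij = (j - i)²`, the element `ψ 1 ψ (a²) + ψ (a²) ψ 1 - 2 ψ(a)²` is a limit of
banded sums with coefficients `((j - i) / N)²`. It therefore vanishes, and `ψ 1` commutes with `ψ
(a²)`. -/
theorem IsOrderZero.sq_of_contraction (hψ : IsOrderZero ψ) :
    ψ a * ψ a = ψ 1 * ψ (a * a) := by
  have h0 := tendsto_norm_sum_hatImage_mul ψ ha ha1 hψ (fun N i j => (((j : ℝ) - i) / N) ^ 2)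
    fun N i j h => by
      rcases N.eq_zero_or_pos with rfl | hN
      · simp
      have hN' : (1 : ℝ) ≤ N := by exact_mod_cast hN
      push Not at h
      have h3 : j ≤ i + 1 := by omega
      have h4 : i ≤ j + 1 := by omega
      have h5 : (j : ℝ) ≤ i + 1 := by exact_mod_cast h3
      have h6 : (i : ℝ) ≤ j + 1 := by exact_mod_cast h4
      have h7 : ((j : ℝ) - i) ^ 2 ≤ 1 := by nlinarith
      rw [abs_of_nonneg (sq_nonneg _), div_pow, div_le_div_iff₀ (by positivity) (by linarith)]
      nlinarith
  have hl := tendsto_sum_div_sq_smul_hatImage ψ ha ha1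
  have h1 := ((hl.const_mul (ψ 1)).add (hl.mul_const (ψ 1))).sub_const
    ((2 : ℝ) • (ψ a * ψ a))
  have h2 : ψ 1 * ψ (a * a) + ψ (a * a) * ψ 1 - (2 : ℝ) • (ψ a * ψ a) = 0 := by
    refine tendsto_nhds_unique (h1.congr' ?_) h0
    filter_upwards [eventually_gt_atTop 0] with N hN
    rw [← sum_div_smul_hatImage ψ ha ha1 hN, ← sum_hatImage ψ ha ha1 N, Finset.sum_mul_sum,
      Finset.sum_mul_sum, Finset.sum_mul_sum, ← Finset.sum_add_distrib, Finset.smul_sum,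
      ← Finset.sum_sub_distrib]
    refine Finset.sum_congr rfl fun i _ => ?_
    rw [← Finset.sum_add_distrib, Finset.smul_sum, ← Finset.sum_sub_distrib]
    refine Finset.sum_congr rfl fun j _ => ?_
    rw [mul_smul_comm, smul_mul_assoc, smul_mul_smul_comm, ← add_smul, smul_smul, ← sub_smul]
    congr 1
    ring
  have h3 : ψ 1 * ψ (a * a) = ψ (a * a) * ψ 1 :=
    IsOrderZero.commute_one_of_contraction ψ
      (by simpa [(IsSelfAdjoint.of_nonneg ha).star_eq] using star_mul_self_nonneg a)
      ((norm_mul_le a a).trans (mul_le_one₀ ha1 (norm_nonneg _) ha1)) hψ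
  rw [← h3, ← two_smul ℝ, ← smul_sub, smul_eq_zero] at h2
  exact (sub_eq_zero.1 (h2.resolve_left two_ne_zero)).symm

end OrderZero

/-! ### Null vectors of positive matrices and multiplicativity of order zero maps -/

section NullVector

variable {B D : Type*} [CStarAlgebra B] [PartialOrder B] [StarOrderedRing B]
  [CStarAlgebra D] [PartialOrder D] [StarOrderedRing D]

theorem eq_zero_of_sum_star_mul_self_eq_zero {ι : Type*} {s : Finset ι} {x : ι → D}
    (h : ∑ k ∈ s, star (x k) * x k = 0) : ∀ k ∈ s, x k = 0 := fun k hk =>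
  (CStarRing.star_mul_self_eq_zero_iff _).1
    ((Finset.sum_eq_zero_iff_of_nonneg fun _ _ => star_mul_self_nonneg _).1 h k hk)

theorem exists_eq_star_mul_self_of_nonneg {C : Type*} [NonUnitalCStarAlgebra C] [PartialOrder C]
    [StarOrderedRing C] {x : C} (hx : 0 ≤ x) : ∃ s : C, x = star s * s :=
  CStarAlgebra.nonneg_iff_eq_star_mul_self.1 hx

/-- A vector on which the quadratic form of a positive matrix vanishes is in its kernel. -/
theorem CStarMatrix.sum_mul_eq_zero_of_nonneg {ι : Type*} [Fintype ι]
    {M : CStarMatrix ι ι D} (hM : 0 ≤ M) (v : ι → D)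
    (h : ∑ i, ∑ j, star (v i) * M i j * v j = 0) (i : ι) : ∑ j, M i j * v j = 0 := by
  classical
  obtain ⟨S, rfl⟩ := exists_eq_star_mul_self_of_nonneg hM
  have hS : ∀ i j, (star S * S) i j = ∑ k, star (S k i) * S k j := fun i j => by
    simp [CStarMatrix.mul_apply, CStarMatrix.star_apply]
  have h1 : ∑ k, star (∑ i, S k i * v i) * (∑ j, S k j * v j) = 0 := by
    rw [← h]
    have h3 : ∀ i j, star (v i) * (star S * S) i j * v j =
        ∑ k, star (S k i * v i) * (S k j * v j) := fun i j => by
      simp only [hS, Finset.mul_sum, Finset.sum_mul, star_mul, mul_assoc]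
    simp only [h3, star_sum, Finset.sum_mul_sum]
    rw [Finset.sum_comm]
    exact Finset.sum_congr rfl fun i _ => Finset.sum_comm
  have h2 := eq_zero_of_sum_star_mul_self_eq_zero h1
  simp only [hS, Finset.sum_mul]
  rw [Finset.sum_comm]
  refine Finset.sum_eq_zero fun k _ => ?_
  simp only [mul_assoc, ← Finset.mul_sum, h2 k (Finset.mem_univ k), mul_zero]

/-- The Gram matrix of a family of elements is positive. -/
theorem CStarMatrix.gram_nonneg {ι : Type*} [Fintype ι] (b : ι → B) :
    0 ≤ (CStarMatrix.ofMatrix fun i j => star (b i) * b j : CStarMatrix ι ι B) := by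
  classical
  rcases isEmpty_or_nonempty ι with hι | ⟨⟨i₀⟩⟩
  · exact le_of_eq (by ext i; exact isEmptyElim i)
  have h : (CStarMatrix.ofMatrix fun i j => star (b i) * b j : CStarMatrix ι ι B) =
      star (CStarMatrix.ofMatrix fun k j => if k = i₀ then b j else 0 : CStarMatrix ι ι B) *
        (CStarMatrix.ofMatrix fun k j => if k = i₀ then b j else 0) := by
    ext i j
    rw [CStarMatrix.mul_apply]
    change star (b i) * b j = ∑ k, star (if k = i₀ then b i else 0) * (if k = i₀ then b j else 0)
    simp
  rw [h]
  exact star_mul_self_nonneg _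

/-- Complete positivity makes the image of the Gram matrix of `x, y, c*` positive. The hypothesis
says that its quadratic form vanishes at `(v, w, 0)`, so this vector lies in the kernel; the third
row is the conclusion. -/
theorem CompletelyPositiveMap.sum_map_mul_eq_zero (ψ : B →CP D) (x y : B) (v w : D)
    (h : star v * ψ (star x * x) * v + star v * ψ (star x * y) * w +
      (star w * ψ (star y * x) * v + star w * ψ (star y * y) * w) = 0) (c : B) :
    ψ (c * x) * v + ψ (c * y) * w = 0 := by
  have h1 := CStarMatrix.sum_mul_eq_zero_of_nonneg
    (ψ.map_cstarMatrix_nonneg _ (CStarMatrix.gram_nonneg ![x, y, star c])) ![v, w, 0]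
  have hM : ∀ i j, (CStarMatrix.map (CStarMatrix.ofMatrix fun i j => star (![x, y, star c] i) *
      ![x, y, star c] j : CStarMatrix (Fin 3) (Fin 3) B) ψ) i j =
        ψ (star (![x, y, star c] i) * ![x, y, star c] j) := fun i j => rfl
  simp only [hM] at h1
  simpa [Fin.sum_univ_three] using h1 (by simpa [Fin.sum_univ_three] using h) 2

/-- A completely positive order zero map is a homomorphism up to the factor `ψ 1`. -/
theorem IsOrderZero.map_mul_map {ψ : B →CP D} (hψ : IsOrderZero ψ) (x y : B) :
    ψ x * ψ y = ψ (x * y) * ψ 1 := by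
  have h := CStarAlgebra.span_nonneg_inter_unitClosedBall (A := B)
  have hy : y ∈ Submodule.span ℂ ({a : B | 0 ≤ a} ∩ Metric.closedBall 0 1) :=
    h ▸ Submodule.mem_top
  induction hy using Submodule.span_induction with
  | mem a ha =>
    have ha1 : ‖a‖ ≤ 1 := by simpa using ha.2
    have ha0 : 0 ≤ a := ha.1
    have hsa : star a = a := (IsSelfAdjoint.of_nonneg ha0).star_eq
    have hc := IsOrderZero.commute_one_of_contraction ψ ha0 ha1 hψ
    have hs := IsOrderZero.sq_of_contraction ψ ha0 ha1 hψ
    have hsk : star (ψ a) = ψ a := by rw [← ψ.map_star', hsa]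
    have hsh : star (ψ 1) = ψ 1 := by rw [← ψ.map_star', star_one]
    -- By the two identities for contractions, the four terms of the quadratic form at `(-ψ a, ψ 1)`
    -- are `± ψ(a)² ψ 1` and cancel.
    have h3 := ψ.sum_map_mul_eq_zero 1 a (-ψ a) (ψ 1) (by
      simp only [star_neg, hsk, hsh, hsa, star_one, one_mul, mul_one, neg_mul, mul_neg, neg_neg]
      rw [← hs, ← hc]
      simp only [mul_assoc, hc]
      abel) x
    rw [mul_one, mul_neg, neg_add_eq_zero] at h3
    exact h3
  | zero => simp
  | add a b _ _ ha hb => simp [mul_add, add_mul, ha, hb]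
  | smul c a _ ha => simp [ha, map_smul]

theorem IsOrderZero.map_mul_map' {ψ : B →CP D} (hψ : IsOrderZero ψ) (x y : B) :
    ψ x * ψ y = ψ 1 * ψ (x * y) := by
  have h := congrArg star (hψ.map_mul_map (star y) (star x))
  simpa only [← star_mul, ← ψ.map_star', star_star, star_one, star_mul] using h

end NullVector

/-! ### Simple unital C⋆-algebras -/

section Simple

variable {A : Type*} [CStarAlgebra A]

theorem exists_fin_sum_of_mem_closure {b x : A}
    (hx : x ∈ AddSubgroup.closure {z : A | ∃ r s, z = r * b * s}) :
    ∃ (m : ℕ) (r s : Fin m → A), ∑ i, r i * b * s i = x := by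
  induction hx using AddSubgroup.closure_induction with
  | mem z hz =>
    obtain ⟨r, s, rfl⟩ := hz
    exact ⟨1, fun _ => r, fun _ => s, by simp⟩
  | zero => exact ⟨0, Fin.elim0, Fin.elim0, by simp⟩
  | add y z _ _ hy hz =>
    obtain ⟨m, r, s, rfl⟩ := hy
    obtain ⟨m', r', s', rfl⟩ := hz
    exact ⟨m + m', Fin.append r r', Fin.append s s', by simp [Fin.sum_univ_add]⟩
  | neg y _ hy =>
    obtain ⟨m, r, s, rfl⟩ := hy
    exact ⟨m, fun i => - r i, s, by simp⟩

/-- In a unital simple C⋆-algebra every nonzero element generates the unit algebraically. -/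
theorem IsSimpleCStarAlgebra.exists_sum_eq_one (hA : IsSimpleCStarAlgebra A) {b : A} (hb : b ≠ 0) :
    ∃ (m : ℕ) (r s : Fin m → A), ∑ i, r i * b * s i = 1 := by
  have := hA.nontrivial
  set S : AddSubgroup A := AddSubgroup.closure {z : A | ∃ r s, z = r * b * s} with hS
  have hl : ∀ x, ∀ z ∈ S, x * z ∈ S := fun x z hz => by
    induction hz using AddSubgroup.closure_induction with
    | mem z hz =>
      obtain ⟨r, s, rfl⟩ := hz
      exact AddSubgroup.subset_closure ⟨x * r, s, by simp only [mul_assoc]⟩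
    | zero => simp
    | add y z _ _ hy hz => rw [mul_add]; exact add_mem hy hz
    | neg y _ hy => rw [mul_neg]; exact neg_mem hy
  have hr : ∀ x, ∀ z ∈ S, z * x ∈ S := fun x z hz => by
    induction hz using AddSubgroup.closure_induction with
    | mem z hz =>
      obtain ⟨r, s, rfl⟩ := hz
      exact AddSubgroup.subset_closure ⟨r, s * x, by simp only [mul_assoc]⟩
    | zero => simp
    | add y z _ _ hy hz => rw [add_mul]; exact add_mem hy hz
    | neg y _ hy => rw [neg_mul]; exact neg_mem hy
  let T := S.topologicalClosure
  let I : TwoSidedIdeal A := .mk' (T : Set A) T.zero_mem T.add_mem T.neg_mem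
    (fun {x y} hy => map_mem_closure (continuous_const_mul x) hy (hl x))
    (fun {y x} hy => map_mem_closure (f := fun z => z * x) (continuous_mul_const x) hy (hr x))
  have hI : (I : Set A) = T := TwoSidedIdeal.coe_mk' ..
  have hbI : b ∈ I := by
    rw [← SetLike.mem_coe, hI]
    exact subset_closure (AddSubgroup.subset_closure ⟨1, 1, by simp⟩)
  rcases hA.eq_bot_or_eq_top I (hI ▸ S.isClosed_topologicalClosure) with h | h
  · rw [h, TwoSidedIdeal.mem_bot] at hbI
    exact absurd hbI hb
  · have h1 : (1 : A) ∈ closure (S : Set A) := by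
      have h2 : (1 : A) ∈ (I : Set A) := by rw [h]; trivial
      rwa [hI] at h2
    -- The units form an open set, so an algebraic ideal with `1` in its closure already contains a
    -- unit, and no closure is needed in the conclusion.
    obtain ⟨z, hz, hzS⟩ := mem_closure_iff.1 h1 _ Units.isOpen isUnit_one
    obtain ⟨u, rfl⟩ := hz
    refine exists_fin_sum_of_mem_closure ?_
    rw [← u.inv_mul]
    exact hl _ _ hzS

/-- This is primeness: if `a A b = 0`, multiplying an expression of `1` as a sum of `r a s` by `b`
gives `b = 0`. -/
theorem IsSimpleCStarAlgebra.exists_mul_mul_ne_zero (hA : IsSimpleCStarAlgebra A) {a b : A}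
    (ha : a ≠ 0) (hb : b ≠ 0) : ∃ c, a * c * b ≠ 0 := by
  by_contra! h
  obtain ⟨m, r, s, hrs⟩ := hA.exists_sum_eq_one ha
  apply hb
  rw [← one_mul b, ← hrs, Finset.sum_mul]
  refine Finset.sum_eq_zero fun i _ => ?_
  rw [mul_assoc (r i), mul_assoc (r i), h, mul_zero]

/-- A unital simple C⋆-algebra with a minimal projection is finite-dimensional. -/
theorem IsSimpleCStarAlgebra.finiteDimensional (hA : IsSimpleCStarAlgebra A) {p : A} (hp : p ≠ 0)
    (h : ∀ d : A, ∃ c : ℂ, p * d * p = c • p) : FiniteDimensional ℂ A := by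
  classical
  obtain ⟨m, r, s, hrs⟩ := hA.exists_sum_eq_one hp
  refine ⟨⟨(Finset.univ.image fun ij : Fin m × Fin m => r ij.1 * p * s ij.2), ?_⟩⟩
  rw [eq_top_iff]
  intro x _
  have hx : x = ∑ i, ∑ j, r i * (p * (s i * x * r j) * p) * s j := by
    calc x = (∑ i, r i * p * s i) * x * ∑ j, r j * p * s j := by rw [hrs, one_mul, mul_one]
      _ = _ := by
        simp only [Finset.sum_mul, Finset.mul_sum, mul_assoc]
        exact Finset.sum_comm
  rw [hx]
  refine Submodule.sum_mem _ fun i _ => Submodule.sum_mem _ fun j _ => ?_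
  obtain ⟨c, hc⟩ := h (s i * x * r j)
  rw [hc, mul_smul_comm, smul_mul_assoc]
  refine Submodule.smul_mem _ _ (Submodule.subset_span ?_)
  simp only [Finset.coe_image, Set.mem_image, Finset.coe_univ, Set.mem_univ, true_and, Prod.exists]
  exact ⟨i, j, rfl⟩

/-- If the right ideal `h A` contains no two nonzero orthogonal elements, then a self-adjoint
element of it has at most one nonzero spectral value. -/
theorem exists_mul_self_eq_smul {h u : A} (hu : IsSelfAdjoint u)
    (hh : ∀ b c, star (h * b) * (h * c) = 0 → h * b = 0 ∨ h * c = 0)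
    {d : A} (hd : u = h * d) : ∃ μ : ℝ, u * u = μ • u := by
  have hkey : ∀ s ∈ spectrum ℝ u, ∀ t ∈ spectrum ℝ u, s ≠ 0 → t ≠ 0 → s < t → False := by
    intro s hs t ht hs0 ht0 hst
    -- Cutting at the midpoint of two nonzero spectral values gives orthogonal elements `u (m - u)₊`
    -- and `u (u - m)₊`. The factor `u` keeps them in `h A`, and each is nonzero because of one of
    -- the two values.
    set m := (s + t) / 2 with hm
    have hex : ∀ f : ℝ → ℝ, Continuous f → cfc (fun r => r * f r) u = h * (d * cfc f u) :=
      fun f hf => by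
        rw [cfc_mul (fun r => r) f u (by fun_prop) (by fun_prop), cfc_id' ℝ u, ← mul_assoc, ← hd]
    have hne : ∀ f : ℝ → ℝ, Continuous f → ∀ r ∈ spectrum ℝ u, r * f r ≠ 0 →
        h * (d * cfc f u) ≠ 0 := fun f hf r hr hrf h0 => by
      rw [← hex f hf, ← cfc_const_zero ℝ u] at h0
      exact hrf (eqOn_of_cfc_eq_cfc h0 (ha := hu) (hf := by fun_prop) (hg := by fun_prop) hr)
    have hf : Continuous fun r : ℝ => max 0 (m - r) := by fun_prop
    have hg : Continuous fun r : ℝ => max 0 (r - m) := by fun_prop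
    rcases hh (d * cfc (fun r : ℝ => max 0 (m - r)) u) (d * cfc (fun r : ℝ => max 0 (r - m)) u) (by
      rw [← hex _ hf, ← hex _ hg, (cfc_predicate (R := ℝ) _ u).star_eq,
        ← cfc_mul _ _ u (by fun_prop) (by fun_prop), ← cfc_const_zero ℝ u]
      congr 1
      ext r
      rcases le_total r m with hr | hr
      · simp [max_eq_left (by linarith : r - m ≤ 0)]
      · simp [max_eq_left (by linarith : m - r ≤ 0)]) with h0 | h0
    · exact hne _ hf s hs (mul_ne_zero hs0 (lt_max_of_lt_right (by linarith)).ne') h0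
    · exact hne _ hg t ht (mul_ne_zero ht0 (lt_max_of_lt_right (by linarith)).ne') h0
  by_cases hμ : ∃ μ ∈ spectrum ℝ u, μ ≠ 0
  · obtain ⟨μ, hμ, hμ0⟩ := hμ
    refine ⟨μ, ?_⟩
    have h1 : cfc (fun r : ℝ => r * r) u = cfc (fun r : ℝ => μ * r) u := by
      refine cfc_congr fun r hr => ?_
      by_cases hr0 : r = 0
      · simp [hr0]
      · rcases lt_trichotomy r μ with hlt | heq | hlt
        · exact (hkey r hr μ hμ hr0 hμ0 hlt).elim
        · simp [heq]
        · exact (hkey μ hμ r hr hμ0 hr0 hlt).elim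
    rwa [cfc_mul (fun r => r) (fun r => r) u (by fun_prop) (by fun_prop),
      cfc_const_mul μ (fun r => r) u (by fun_prop), cfc_id' ℝ u] at h1
  · push Not at hμ
    have h1 : cfc (fun r : ℝ => r) u = cfc (fun _ : ℝ => (0 : ℝ)) u := cfc_congr hμ
    rw [cfc_id' ℝ u, cfc_const_zero] at h1
    exact ⟨0, by simp [h1]⟩

/-- In an infinite-dimensional unital simple C⋆-algebra every nonzero right ideal `h A` contains
two nonzero orthogonal elements. -/
theorem IsSimpleCStarAlgebra.exists_orthogonal_pair (hA : IsSimpleCStarAlgebra A)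
    (hdim : ¬ FiniteDimensional ℂ A) {h : A} (hne : h ≠ 0) :
    ∃ b c, h * b ≠ 0 ∧ h * c ≠ 0 ∧ star (h * b) * (h * c) = 0 := by
  by_contra! hcon
  have hh : ∀ b c, star (h * b) * (h * c) = 0 → h * b = 0 ∨ h * c = 0 := fun b c h0 => by
    by_contra! h1
    exact hcon b c h1.1 h1.2 h0
  have hk : h * star h ≠ 0 := fun h0 => hne ((CStarRing.mul_star_self_eq_zero_iff h).1 h0)
  have hksa : IsSelfAdjoint (h * star h) := IsSelfAdjoint.mul_star_self h
  obtain ⟨l, hl⟩ := exists_mul_self_eq_smul hksa hh rfl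
  have hl0 : l ≠ 0 := fun h0 => by
    rw [h0, zero_smul] at hl
    nth_rw 1 [← hksa.star_eq] at hl
    exact hk ((CStarRing.star_mul_self_eq_zero_iff _).1 hl)
  set p : A := l⁻¹ • (h * star h) with hp
  have hpsa : IsSelfAdjoint p := by
    rw [hp]; exact IsSelfAdjoint.smul (IsSelfAdjoint.all _) hksa
  have hpp : p * p = p := by
    rw [hp, smul_mul_smul_comm, hl, smul_smul]
    congr 1
    field_simp
  have hph : p = h * (l⁻¹ • star h) := by rw [hp, mul_smul_comm]
  have hp0 : p ≠ 0 := smul_ne_zero (inv_ne_zero hl0) hk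
  clear_value p
  have hsa : ∀ d : A, IsSelfAdjoint d → ∃ μ : ℝ, p * d * p = μ • p := fun d hd => by
    have husa : IsSelfAdjoint (p * d * p) := by
      rw [isSelfAdjoint_iff]
      simp only [star_mul, hpsa.star_eq, hd.star_eq, mul_assoc]
    have huh : p * d * p = h * ((l⁻¹ • star h) * d * p) := by
      rw [← mul_assoc, ← mul_assoc, ← hph]
    obtain ⟨μ, hμ⟩ := exists_mul_self_eq_smul husa hh huh
    have hup : p * d * p * p = p * d * p := by rw [mul_assoc, hpp]
    -- With `u = p d p` and `u² = μ u`, the elements `u` and `u - μ p` of `h A` are orthogonal, so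
    -- one vanishes. Either way `u` is a multiple of `p`, which makes `p` minimal.
    rcases hh ((l⁻¹ • star h) * d * p) ((l⁻¹ • star h) * d * p - μ • (l⁻¹ • star h)) (by
      rw [mul_sub, mul_smul_comm, ← huh, ← hph, husa.star_eq, mul_sub, hμ, mul_smul_comm, hup,
        sub_self]) with h0 | h0
    · exact ⟨0, by rw [huh, h0, zero_smul]⟩
    · rw [mul_sub, mul_smul_comm, ← huh, ← hph] at h0
      exact ⟨μ, sub_eq_zero.1 h0⟩
  refine hdim (hA.finiteDimensional hp0 fun d => ?_)
  obtain ⟨μ, hμ⟩ := hsa _ (realPart d).2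
  obtain ⟨ν, hν⟩ := hsa _ (imaginaryPart d).2
  refine ⟨(μ : ℂ) + Complex.I * ν, ?_⟩
  conv_lhs => rw [← realPart_add_I_smul_imaginaryPart d]
  rw [mul_add, add_mul, mul_smul_comm, smul_mul_assoc, hμ, hν, add_smul, mul_smul,
    Complex.coe_smul, Complex.coe_smul]

/-- Keep one element of an orthogonal pair and recurse inside the right ideal generated by the
other. -/
theorem IsSimpleCStarAlgebra.exists_orthogonal (hA : IsSimpleCStarAlgebra A)
    (hdim : ¬ FiniteDimensional ℂ A) (N : ℕ) : ∀ {h : A}, h ≠ 0 → ∃ b : Fin N → A,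
      (∀ i, h * b i ≠ 0) ∧ ∀ i j, i ≠ j → star (h * b i) * (h * b j) = 0 := by
  induction N with
  | zero => exact fun _ => ⟨Fin.elim0, fun i => i.elim0, fun i => i.elim0⟩
  | succ N ih =>
    intro h hne
    obtain ⟨b, c, hb, hc, hbc⟩ := hA.exists_orthogonal_pair hdim hne
    obtain ⟨d, hd, hdd⟩ := ih hc
    have hbd : ∀ i, star (h * b) * (h * (c * d i)) = 0 := fun i => by
      rw [← mul_assoc h, ← mul_assoc, hbc, zero_mul]
    refine ⟨Fin.cons b fun i => c * d i, Fin.cases (by simpa) fun i => ?_,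
      Fin.cases (Fin.cases (by simp) fun j _ => ?_) fun i => Fin.cases (fun _ => ?_) fun j hij => ?_⟩
    · simpa [← mul_assoc] using hd i
    · simpa using hbd j
    · have := congrArg star (hbd i)
      simpa [mul_assoc] using this
    · have := hdd i j (by simpa using hij)
      simpa [← mul_assoc] using this

variable [PartialOrder A] [StarOrderedRing A]

/-- Finitely many nonzero right ideals of a unital simple C⋆-algebra contain equivalent elements. -/
theorem IsSimpleCStarAlgebra.exists_equivalent (hA : IsSimpleCStarAlgebra A) (N : ℕ) :
    ∀ a : Fin N → A, (∀ i, a i ≠ 0) → ∃ (c : Fin N → A) (y : A), 0 ≤ y ∧ y ≠ 0 ∧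
      ∀ i, star (a i * c i) * (a i * c i) = y := by
  have := hA.nontrivial
  induction N with
  | zero => exact fun a _ => ⟨Fin.elim0, 1, zero_le_one, one_ne_zero, fun i => i.elim0⟩
  | succ N ih =>
    intro a ha
    obtain ⟨c, y, hy, hy0, hc⟩ := ih (fun i => a i.succ) fun i => ha i.succ
    obtain ⟨c₀, hc₀⟩ := hA.exists_mul_mul_ne_zero (ha 0) hy0
    set d := star (a 0 * c₀) * (a 0 * c₀) with hd
    have hysa : star y = y := (IsSelfAdjoint.of_nonneg hy).star_eq
    have hdsa : star d = d := by rw [hd]; simp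
    have hz : star (a 0 * c₀ * y) * (a 0 * c₀ * y) = y * d * y := by
      rw [star_mul, hysa, hd]; simp only [mul_assoc]
    have hzn : 0 ≤ y * d * y := hz ▸ star_mul_self_nonneg _
    have hzsa : star (y * d * y) = y * d * y := (IsSelfAdjoint.of_nonneg hzn).star_eq
    have hz0 : y * d * y ≠ 0 := hz ▸ fun h0 =>
      hc₀ ((CStarRing.star_mul_self_eq_zero_iff _).1 h0)
    have hry : CFC.sqrt y * CFC.sqrt y = y := CFC.sqrt_mul_sqrt_self y hy
    have hrs : star (CFC.sqrt y) = CFC.sqrt y :=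
      (IsSelfAdjoint.of_nonneg (CFC.sqrt_nonneg y)).star_eq
    have hrz : CFC.sqrt (y * d * y) * CFC.sqrt (y * d * y) = y * d * y :=
      CFC.sqrt_mul_sqrt_self _ hzn
    have hrzs : star (CFC.sqrt (y * d * y)) = CFC.sqrt (y * d * y) :=
      (IsSelfAdjoint.of_nonneg (CFC.sqrt_nonneg _)).star_eq
    have hcomm : ∀ z w : A, z * z = w → z * w = w * z := fun z w h => by
      rw [← h, mul_assoc]
    -- Both kinds of witness are chosen to produce the same square `z²`, where `z = y d y`: the new
    -- one as `√z z √z`, the old ones as `y d (√y y √y) d y`.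
    refine ⟨Fin.cons (c₀ * y * CFC.sqrt (y * d * y)) fun i => c i * (CFC.sqrt y * d * y),
      (y * d * y) * (y * d * y), ?_, ?_, Fin.cases ?_ fun i => ?_⟩
    · nth_rw 1 [← hzsa]
      exact star_mul_self_nonneg _
    · nth_rw 1 [← hzsa]
      exact fun h0 => hz0 ((CStarRing.star_mul_self_eq_zero_iff _).1 h0)
    · simp only [Fin.cons_zero]
      calc star (a 0 * (c₀ * y * CFC.sqrt (y * d * y))) * (a 0 * (c₀ * y * CFC.sqrt (y * d * y)))
          = star (CFC.sqrt (y * d * y)) * (star (a 0 * c₀ * y) * (a 0 * c₀ * y)) *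
            CFC.sqrt (y * d * y) := by simp only [star_mul, mul_assoc]
        _ = _ := by rw [hz, hrzs, hcomm _ _ hrz, mul_assoc, hrz]
    · simp only [Fin.cons_succ]
      calc star (a i.succ * (c i * (CFC.sqrt y * d * y))) * (a i.succ * (c i * (CFC.sqrt y * d * y)))
          = star (CFC.sqrt y * d * y) * (star (a i.succ * c i) * (a i.succ * c i)) *
            (CFC.sqrt y * d * y) := by simp only [star_mul, mul_assoc]
        _ = y * d * (CFC.sqrt y * y * CFC.sqrt y) * d * y := by
          rw [hc i, star_mul, star_mul, hysa, hdsa, hrs]; simp only [mul_assoc]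
        _ = _ := by rw [hcomm _ _ hry, mul_assoc y (CFC.sqrt y), hry]; simp only [mul_assoc]

/-- A positive element of norm at least `δ` of an infinite-dimensional unital simple C⋆-algebra
dominates `N` orthogonal copies of a positive element of norm one, with bounded witnesses. -/
theorem IsSimpleCStarAlgebra.exists_orthogonal_copies (hA : IsSimpleCStarAlgebra A)
    (hdim : ¬ FiniteDimensional ℂ A) (N : ℕ) {δ : ℝ} (hδ : 0 < δ) {x : A} (hx : 0 ≤ x)
    (hxδ : δ ≤ ‖x‖) : ∃ (y : A) (w : Fin N → A), 0 ≤ y ∧ ‖y‖ = 1 ∧ (∀ i, ‖w i‖ ≤ (√(δ / 2))⁻¹) ∧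
      ∀ i j, star (w i) * x * w j = if i = j then y else 0 := by
  have := hA.nontrivial
  -- Copies are sought in `h A` with `h = (x - δ/2)₊`. On the support of `h` the function `g` is `x
  -- ^ (-1/2)`, so `g x g` fixes `h A`. Capping `g` at `(δ/2) ^ (-1/2)` makes the witnesses bounded
  -- in terms of `δ` alone, as sequences in the ultrapower require.
  set h := cfc (fun t : ℝ => max 0 (t - δ / 2)) x with hh
  set g := cfc (fun t : ℝ => (√(max t (δ / 2)))⁻¹) x with hg
  have hδ2 : 0 < δ / 2 := half_pos hδ
  have hpos : ∀ t : ℝ, 0 < √(max t (δ / 2)) := fun t =>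
    Real.sqrt_pos.2 (lt_max_of_lt_right hδ2)
  have hgc : Continuous fun t : ℝ => (√(max t (δ / 2)))⁻¹ :=
    Continuous.inv₀ (by fun_prop) fun t => (hpos t).ne'
  have hxsa : IsSelfAdjoint x := .of_nonneg hx
  have hh0 : h ≠ 0 := fun h0 => by
    rw [hh, ← cfc_const_zero ℝ x] at h0
    have h1 := eqOn_of_cfc_eq_cfc h0 (ha := hxsa) (hf := by fun_prop) (hg := by fun_prop)
      (CStarAlgebra.norm_mem_spectrum_of_nonneg hx)
    have h2 : max 0 (‖x‖ - δ / 2) = 0 := h1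
    linarith [le_max_right 0 (‖x‖ - δ / 2)]
  have hgsa : star g = g := (cfc_predicate (R := ℝ) _ x).star_eq
  have hgxg : g * x * g * h = h := by
    rw [hg, hh]
    nth_rw 2 [← cfc_id' ℝ x]
    rw [← cfc_mul _ _ x hgc.continuousOn (by fun_prop),
      ← cfc_mul _ _ x (hgc.fun_mul continuous_id').continuousOn hgc.continuousOn,
      ← cfc_mul _ _ x ((hgc.fun_mul continuous_id').fun_mul hgc).continuousOn (by fun_prop)]
    refine cfc_congr fun t _ => ?_
    rcases le_total t (δ / 2) with ht | ht
    · simp [max_eq_left (by linarith : t - δ / 2 ≤ 0)]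
    · have h1 : √t * √t = t := Real.mul_self_sqrt (by linarith)
      have h2 : √t ≠ 0 := by have := (hpos t).ne'; rwa [max_eq_left ht] at this
      simp only [max_eq_left ht]
      field_simp
      rw [sq, h1]
  have hgn : ‖g‖ ≤ (√(δ / 2))⁻¹ := norm_cfc_le (by positivity) fun t _ => by
    rw [Real.norm_of_nonneg (by positivity)]
    exact inv_anti₀ (Real.sqrt_pos.2 hδ2) (Real.sqrt_le_sqrt (le_max_right _ _))
  obtain ⟨b, hb, hbb⟩ := hA.exists_orthogonal hdim N hh0
  obtain ⟨c, y, hy, hy0, hc⟩ := hA.exists_equivalent N _ hb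
  have hyn : 0 < ‖y‖ := norm_pos_iff.2 hy0
  set κ : ℝ := (√‖y‖)⁻¹ with hκ
  have hκκ : κ * κ = ‖y‖⁻¹ := by
    rw [hκ, ← mul_inv, Real.mul_self_sqrt hyn.le]
  set v : Fin N → A := fun i => κ • (h * b i * c i) with hv
  have hvv : ∀ i j, star (v i) * v j = if i = j then ‖y‖⁻¹ • y else 0 := fun i j => by
    simp only [hv, star_smul, smul_mul_smul_comm, star_trivial, hκκ]
    split_ifs with hij
    · rw [hij, hc]
    · rw [star_mul, mul_assoc, ← mul_assoc (star (h * b i)), hbb i j hij]; simp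
  have hyn1 : ‖‖y‖⁻¹ • y‖ = 1 := by
    rw [norm_smul, norm_inv, norm_norm, inv_mul_cancel₀ hyn.ne']
  have hgv : ∀ i, g * x * g * v i = v i := fun i => by
    simp only [hv, mul_smul_comm]
    rw [mul_assoc h, ← mul_assoc _ h, hgxg]
  refine ⟨‖y‖⁻¹ • y, fun i => g * v i, smul_nonneg (by positivity) hy, hyn1, fun i => ?_,
    fun i j => ?_⟩
  · have h1 : ‖v i‖ = 1 := by
      have h2 := congrArg norm (hvv i i)
      rw [if_pos rfl, hyn1, CStarRing.norm_star_mul_self, ← sq] at h2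
      exact (pow_eq_one_iff_of_nonneg (norm_nonneg _) two_ne_zero).1 h2
    refine (norm_mul_le _ _).trans ?_
    rwa [h1, mul_one]
  · rw [← hvv, ← hgv j, star_mul, hgsa]
    simp only [mul_assoc]

end Simple

/-! ### Elements of the ultrapower -/

section UltrapowerElements

variable (ω : Ultrafilter ℕ) {A : Type*} [CStarAlgebra A] [Nontrivial A]

/-- A bounded sequence as an element of `ℓ^∞(ℕ, A)`. -/
noncomputable def boundedSeq {E : Type*} [NormedAddCommGroup E] (f : ℕ → E) (C : ℝ) (h : ∀ k, ‖f k‖ ≤ C) :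
    lp (fun _ : ℕ => E) ∞ :=
  ⟨f, memℓp_infty ⟨C, by rintro _ ⟨k, rfl⟩; exact h k⟩⟩

theorem Ultrapower.mk_eq_mk_of_eventually {a b : lp (fun _ : ℕ => A) ∞}
    (h : ∀ᶠ k in (ω : Filter ℕ), a k = b k) : mk ω a = mk ω b := by
  rw [mk_eq_mk_iff]
  refine tendsto_const_nhds.congr' ?_
  filter_upwards [h] with k hk
  simp [hk]

theorem Ultrapower.mk_eq_zero_iff {a : lp (fun _ : ℕ => A) ∞} :
    mk ω a = 0 ↔ Tendsto (fun k => ‖a k‖) ω (𝓝 0) := by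
  rw [← map_zero (mk ω), mk_eq_mk_iff]
  simp

variable [PartialOrder A] [StarOrderedRing A]

/-- A nonzero positive element of the ultrapower of an infinite-dimensional unital simple
C⋆-algebra dominates `N` orthogonal copies of a nonzero positive element. -/
theorem Ultrapower.exists_orthogonal_copies (hA : IsSimpleCStarAlgebra A)
    (hdim : ¬ FiniteDimensional ℂ A) (N : ℕ) {x : Ultrapower ω A} (hx : 0 ≤ x) (hx0 : x ≠ 0) :
    ∃ (y : Ultrapower ω A) (w : Fin N → Ultrapower ω A), 0 ≤ y ∧ y ≠ 0 ∧
      ∀ i j, star (w i) * x * w j = if i = j then y else 0 := by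
  obtain ⟨s, rfl⟩ := exists_eq_star_mul_self_of_nonneg hx
  obtain ⟨b, rfl⟩ := mk_surjective ω s
  rw [star_mk, ← map_mul] at hx0 ⊢
  set δ := ‖mk ω (star b * b)‖ / 2 with hδ
  have hδ0 : 0 < δ := half_pos (norm_pos_iff.2 hx0)
  have hev : ∀ᶠ k in (ω : Filter ℕ), δ ≤ ‖(star b * b) k‖ :=
    ((tendsto_norm_mk ω (star b * b)).eventually_const_lt (half_lt_self (norm_pos_iff.2 hx0))).mono
      fun k hk => le_of_lt hk
  have hex : ∀ k, ∃ (y : A) (w : Fin N → A), 0 ≤ y ∧ ‖y‖ = 1 ∧ (∀ i, ‖w i‖ ≤ (√(δ / 2))⁻¹) ∧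
      (δ ≤ ‖(star b * b) k‖ →
        ∀ i j, star (w i) * (star b * b) k * w j = if i = j then y else 0) := fun k => by
    by_cases hk : δ ≤ ‖(star b * b) k‖
    · obtain ⟨y, w, h1, h2, h3, h4⟩ := hA.exists_orthogonal_copies hdim N hδ0
        (show 0 ≤ (star b * b) k from star_mul_self_nonneg (b k)) hk
      exact ⟨y, w, h1, h2, h3, fun _ => h4⟩
    -- At the `ω`-negligible indices where the norm is small, any values within the bounds serve;
    -- taking `y = 1` keeps `‖y‖ = 1` at every index.
    · exact ⟨1, 0, zero_le_one, norm_one, fun i => by simp only [Pi.zero_apply, norm_zero]; positivity, fun h => absurd h hk⟩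
  choose y w hy hy1 hw hyw using hex
  refine ⟨mk ω (boundedSeq y 1 fun k => (hy1 k).le),
    fun i => mk ω (boundedSeq (fun k => w k i) _ fun k => hw k i), ?_, fun h => ?_, fun i j => ?_⟩
  · have h1 : ∀ k, ‖CFC.sqrt (y k)‖ ≤ 1 := fun k => by
      have h2 := CStarRing.norm_star_mul_self (x := CFC.sqrt (y k))
      rw [(IsSelfAdjoint.of_nonneg (CFC.sqrt_nonneg (y k))).star_eq,
        CFC.sqrt_mul_sqrt_self _ (hy k), hy1] at h2
      nlinarith [norm_nonneg (CFC.sqrt (y k))]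
    have h3 : boundedSeq y 1 (fun k => (hy1 k).le) =
        star (boundedSeq (fun k => CFC.sqrt (y k)) 1 h1) *
          boundedSeq (fun k => CFC.sqrt (y k)) 1 h1 := by
      ext k
      change y k = star (CFC.sqrt (y k)) * CFC.sqrt (y k)
      rw [(IsSelfAdjoint.of_nonneg (CFC.sqrt_nonneg (y k))).star_eq,
        CFC.sqrt_mul_sqrt_self _ (hy k)]
    rw [h3, map_mul, ← star_mk]
    exact star_mul_self_nonneg _
  · rw [mk_eq_zero_iff] at h
    refine one_ne_zero (tendsto_nhds_unique (tendsto_const_nhds.congr fun k => ?_) h)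
    exact (hy1 k).symm
  · rw [star_mk, ← map_mul, ← map_mul]
    have h0 : (if i = j then mk ω (boundedSeq y 1 fun k => (hy1 k).le) else 0) =
        mk ω (if i = j then boundedSeq y 1 fun k => (hy1 k).le else 0) := by
      split_ifs <;> simp
    rw [h0]
    refine mk_eq_mk_of_eventually ω (hev.mono fun k hk => ?_)
    refine (hyw k hk i j).trans ?_
    split_ifs <;> rfl

end UltrapowerElements

/-! ### Scalar matrices and norms of matrices -/

section ScalarMatrix

variable {n : ℕ} {D : Type*} [CStarAlgebra D]

theorem elemTensor_one_one : (elemTensor 1 1 : CStarMatrix (Fin n) (Fin n) D) = 1 := by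
  ext i j
  simp [elemTensor_apply, CStarMatrix.one_apply, Matrix.one_apply, ite_smul]

/-- The embedding `a ↦ a ⊗ 1` of `D` into `D ⊗ M_n`. -/
noncomputable def scalarHom (n : ℕ) (D : Type*) [CStarAlgebra D] : D →⋆ₐ[ℂ] CStarMatrix (Fin n) (Fin n) D where
  toFun a := elemTensor a 1
  map_one' := elemTensor_one_one
  map_mul' a b := by rw [elemTensor_mul, mul_one]
  map_zero' := by ext i j; simp [elemTensor_apply]
  map_add' a b := elemTensor_add a b 1
  commutes' c := by
    rw [Algebra.algebraMap_eq_smul_one, elemTensor_smul, elemTensor_one_one,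
      Algebra.algebraMap_eq_smul_one]
  map_star' a := by rw [star_elemTensor, star_one]

theorem scalarHom_apply (a : D) : scalarHom n D a = elemTensor a 1 := rfl

theorem scalarHom_apply_apply (a : D) (i j : Fin n) :
    scalarHom n D a i j = if i = j then a else 0 := by
  simp [scalarHom_apply, elemTensor_apply, Matrix.one_apply, ite_smul]

variable [PartialOrder D] [StarOrderedRing D]

/-- Only control by the entries matters, so the norms of the matrix units are left uncomputed. -/
theorem CStarMatrix.norm_le_sum_norm (M : CStarMatrix (Fin n) (Fin n) D) :
    ‖M‖ ≤ ∑ i, ∑ j, ‖M i j‖ *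
      ‖(elemTensor 1 (Matrix.single i j 1) : CStarMatrix (Fin n) (Fin n) D)‖ := by
  conv_lhs => rw [eq_sum_elemTensor M]
  refine norm_sum_le_of_le _ fun i _ => norm_sum_le_of_le _ fun j _ => ?_
  have h : elemTensor (M i j) (Matrix.single i j 1) =
      scalarHom n D (M i j) * elemTensor 1 (Matrix.single i j 1) := by
    rw [scalarHom_apply, elemTensor_mul, mul_one, one_mul]
  rw [h]
  refine (norm_mul_le _ _).trans ?_
  gcongr
  exact NonUnitalStarAlgHom.norm_apply_le (scalarHom n D) (M i j)

theorem CStarMatrix.tendsto_norm_zero {ι : Type*} {l : Filter ι}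
    {M : ι → CStarMatrix (Fin n) (Fin n) D}
    (h : ∀ i j, Tendsto (fun k => ‖M k i j‖) l (𝓝 0)) : Tendsto (fun k => ‖M k‖) l (𝓝 0) := by
  refine squeeze_zero (fun k => norm_nonneg _) (fun k => CStarMatrix.norm_le_sum_norm (M k)) ?_
  rw [show (0 : ℝ) = ∑ i : Fin n, ∑ j : Fin n, 0 *
    ‖(elemTensor 1 (Matrix.single i j 1) : CStarMatrix (Fin n) (Fin n) D)‖ by simp]
  exact tendsto_finsetSum _ fun i _ => tendsto_finsetSum _ fun j _ => (h i j).mul_const _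

end ScalarMatrix

/-! ### The ultrapower of a matrix algebra -/

section UltrapowerMatrix

namespace Ultrapower

variable (ω : Ultrafilter ℕ) {n : ℕ} [NeZero n] {A : Type*} [CStarAlgebra A] [Nontrivial A]
  [PartialOrder A] [StarOrderedRing A]

omit [NeZero n] [Nontrivial A] in
/-- An entry of a bounded sequence of matrices. -/
noncomputable def entrySeq (i j : Fin n) (a : lp (fun _ : ℕ => CStarMatrix (Fin n) (Fin n) A) ∞) :
    lp (fun _ : ℕ => A) ∞ :=
  boundedSeq (fun k => a k i j) ‖a‖ fun k =>
    CStarMatrix.norm_entry_le_norm.trans (lp.norm_apply_le_norm ENNReal.top_ne_zero a k)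

/-- An entry of an element of the ultrapower of a matrix algebra. -/
noncomputable def entry (i j : Fin n) : Ultrapower ω (CStarMatrix (Fin n) (Fin n) A) → Ultrapower ω A :=
  Quotient.lift (fun a => mk ω (entrySeq i j a)) fun a b hab => by
    have h : mk ω a = mk ω b := Quotient.sound hab
    rw [mk_eq_mk_iff] at h ⊢
    exact squeeze_zero (fun k => norm_nonneg _)
      (fun k => CStarMatrix.norm_entry_le_norm (M := a k - b k) (i := i) (j := j)) h

/-- The ⋆-homomorphism `(M_n(A))_ω → M_n(A_ω)`. -/
noncomputable def toMatrix (n : ℕ) [NeZero n] (A : Type*) [CStarAlgebra A] [Nontrivial A]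
    [PartialOrder A] [StarOrderedRing A] :
    Ultrapower ω (CStarMatrix (Fin n) (Fin n) A) →⋆ₐ[ℂ]
      CStarMatrix (Fin n) (Fin n) (Ultrapower ω A) where
  toFun x := CStarMatrix.ofMatrix fun i j => entry ω i j x
  map_one' := by
    ext i j
    rw [← map_one (mk ω), CStarMatrix.one_apply]
    change mk ω (entrySeq (A := A) i j 1) = _
    rw [show (if i = j then (1 : Ultrapower ω A) else 0) = mk ω (if i = j then 1 else 0) by
      split_ifs <;> simp]
    congr 1
    ext k
    change (1 : CStarMatrix (Fin n) (Fin n) A) i j = _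
    rw [CStarMatrix.one_apply]
    split_ifs <;> rfl
  map_mul' x y := by
    obtain ⟨a, rfl⟩ := mk_surjective ω x
    obtain ⟨b, rfl⟩ := mk_surjective ω y
    ext i j
    rw [← map_mul, CStarMatrix.mul_apply]
    change mk ω (entrySeq i j (a * b)) = ∑ l, mk ω (entrySeq i l a) * mk ω (entrySeq l j b)
    simp only [← map_mul, ← map_sum]
    congr 1
    ext k
    rw [lp.coeFn_sum, Finset.sum_apply]
    exact CStarMatrix.mul_apply
  map_zero' := by
    ext i j
    rw [← map_zero (mk ω)]
    change mk ω (entrySeq i j 0) = 0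
    rw [← map_zero (mk ω)]
    rfl
  map_add' x y := by
    obtain ⟨a, rfl⟩ := mk_surjective ω x
    obtain ⟨b, rfl⟩ := mk_surjective ω y
    ext i j
    rw [← map_add, CStarMatrix.add_apply]
    change mk ω (entrySeq i j (a + b)) = mk ω (entrySeq i j a) + mk ω (entrySeq i j b)
    rw [← map_add]
    rfl
  commutes' c := by
    ext i j
    rw [CStarMatrix.algebraMap_apply, ← (mk ω).commutes c]
    change mk ω (entrySeq i j (algebraMap ℂ _ c)) = _
    rw [show (if i = j then algebraMap ℂ (Ultrapower ω A) c else 0) =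
      mk ω (if i = j then algebraMap ℂ _ c else 0) by split_ifs <;> simp]
    congr 1
    ext k
    change (algebraMap ℂ (CStarMatrix (Fin n) (Fin n) A) c) i j = _
    rw [CStarMatrix.algebraMap_apply]
    split_ifs <;> rfl
  map_star' x := by
    obtain ⟨a, rfl⟩ := mk_surjective ω x
    rfl

/-- The matrix norm is controlled by the finitely many entries: entrywise null sequences are null,
which gives injectivity, and entrywise bounded ones are bounded, which gives surjectivity. -/
theorem toMatrix_bijective : Function.Bijective (toMatrix ω n A) := by
  constructor
  · rw [injective_iff_map_eq_zero]
    intro x hx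
    obtain ⟨a, rfl⟩ := mk_surjective ω x
    rw [mk_eq_zero_iff]
    refine CStarMatrix.tendsto_norm_zero fun i j => ?_
    exact (mk_eq_zero_iff ω).1 (congrFun (congrFun hx i) j)
  · intro Y
    choose b hb using fun i j => mk_surjective ω (Y i j)
    refine ⟨mk ω (boundedSeq (fun k => CStarMatrix.ofMatrix fun i j => b i j k)
      (∑ i, ∑ j, ‖b i j‖ *
        ‖(elemTensor 1 (Matrix.single i j 1) : CStarMatrix (Fin n) (Fin n) A)‖) fun k => ?_), ?_⟩
    · refine (CStarMatrix.norm_le_sum_norm _).trans ?_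
      gcongr with i _ j _
      exact lp.norm_apply_le_norm ENNReal.top_ne_zero (b i j) k
    · ext i j
      rw [← hb i j]
      rfl

/-- The isomorphism `(M_n(A))_ω ≃ M_n(A_ω)`. -/
noncomputable def matrixEquiv (n : ℕ) [NeZero n] (A : Type*) [CStarAlgebra A] [Nontrivial A]
    [PartialOrder A] [StarOrderedRing A] :
    Ultrapower ω (CStarMatrix (Fin n) (Fin n) A) ≃⋆ₐ[ℂ]
      CStarMatrix (Fin n) (Fin n) (Ultrapower ω A) :=
  StarAlgEquiv.ofBijective (toMatrix ω n A) (toMatrix_bijective ω)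

theorem matrixEquiv_mk_apply (a : lp (fun _ : ℕ => CStarMatrix (Fin n) (Fin n) A) ∞)
    (i j : Fin n) : matrixEquiv ω n A (mk ω a) i j = mk ω (entrySeq i j a) := rfl

theorem matrixEquiv_diag (M : CStarMatrix (Fin n) (Fin n) A) :
    matrixEquiv ω n A (diag ω _ M) = CStarMatrix.mapₙₐ (diag ω A : A →⋆ₙₐ[ℂ] Ultrapower ω A) M := by
  ext i j
  rfl

theorem matrixEquiv_action {G : Type*} [Group G] (α : G →* (A ≃⋆ₐ[ℂ] A))
    (ρ : G →* (Matrix (Fin n) (Fin n) ℂ ≃⋆ₐ[ℂ] Matrix (Fin n) (Fin n) ℂ)) (g : G)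
    (x : Ultrapower ω (CStarMatrix (Fin n) (Fin n) A)) :
    matrixEquiv ω n A (action ω (tensorAction α ρ) g x) =
      tensorAction (action ω α) ρ g (matrixEquiv ω n A x) := by
  obtain ⟨a, rfl⟩ := mk_surjective ω x
  ext i j
  rw [action_mk, matrixEquiv_mk_apply]
  change _ = (∑ k, ∑ l, elemTensor (action ω α g (matrixEquiv ω n A (mk ω a) k l))
    (ρ g (Matrix.single k l 1))) i j
  simp only [sum_matrix_apply, elemTensor_apply, matrixEquiv_mk_apply, action_mk, ← map_smul,
    ← map_sum]
  congr 1
  ext k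
  simp only [lp.coeFn_sum, Finset.sum_apply, lp.coeFn_smul, Pi.smul_apply]
  change (∑ p, ∑ q, elemTensor (α g (a k p q)) (ρ g (Matrix.single p q 1))) i j = _
  simp only [sum_matrix_apply, elemTensor_apply]
  rfl

end Ultrapower

end UltrapowerMatrix

/-! ### Operations on completely positive maps -/

section CompletelyPositive

variable {B C D : Type*} [CStarAlgebra B] [PartialOrder B] [StarOrderedRing B]
  [CStarAlgebra C] [PartialOrder C] [StarOrderedRing C]
  [CStarAlgebra D] [PartialOrder D] [StarOrderedRing D]

namespace CompletelyPositiveMap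

/-- The composition of completely positive maps. -/
noncomputable def comp (χ : C →CP D) (ψ : B →CP C) : B →CP D where
  toLinearMap := χ.toLinearMap ∘ₗ ψ.toLinearMap
  map_cstarMatrix_nonneg' k M hM :=
    χ.map_cstarMatrix_nonneg' k _ (ψ.map_cstarMatrix_nonneg' k M hM)

/-- A ⋆-homomorphism as a completely positive map. -/
noncomputable def ofStarHom (f : B →⋆ₐ[ℂ] C) : B →CP C where
  toLinearMap := (f : B →ₗ[ℂ] C)
  map_cstarMatrix_nonneg' k M hM := CompletelyPositiveMapClass.map_cstarMatrix_nonneg' f k M hM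

/-- The zero map is completely positive. -/
noncomputable def zero (B D : Type*) [CStarAlgebra B] [PartialOrder B] [StarOrderedRing B]
    [CStarAlgebra D] [PartialOrder D] [StarOrderedRing D] : B →CP D where
  toLinearMap := 0
  map_cstarMatrix_nonneg' _ _ _ := le_of_eq rfl

theorem zero_apply (b : B) : zero B D b = 0 := rfl

omit [PartialOrder D] [StarOrderedRing D] in
theorem _root_.CStarMatrix.star_mul_self_apply {ι : Type*} [Fintype ι] (S : CStarMatrix ι ι D)
    (i j : ι) : (star S * S) i j = ∑ k, star (S k i) * S k j := by
  simp [CStarMatrix.mul_apply, CStarMatrix.star_apply]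

/-- The amplification `ψ ⊗ id` of a completely positive map to matrices. -/
noncomputable def amplify (n : ℕ) (ψ : B →CP D) :
    CStarMatrix (Fin n) (Fin n) B →CP CStarMatrix (Fin n) (Fin n) D where
  toLinearMap := CStarMatrix.mapₗ ψ.toLinearMap
  map_cstarMatrix_nonneg' k M hM := by
    obtain ⟨S, rfl⟩ := exists_eq_star_mul_self_of_nonneg hM
    -- Regrouping indices identifies `M_k(M_n(B))` with `M_{k×n}(B)`. Positivity is carried across
    -- by regrouping the factors `S` and `T` of `S* S` and `T* T`.
    let S' : CStarMatrix (Fin k × Fin n) (Fin k × Fin n) B :=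
      CStarMatrix.ofMatrix fun a b => S a.1 b.1 a.2 b.2
    obtain ⟨T, hT⟩ := exists_eq_star_mul_self_of_nonneg
      (ψ.map_cstarMatrix_nonneg (star S' * S') (star_mul_self_nonneg S'))
    let T' : CStarMatrix (Fin k) (Fin k) (CStarMatrix (Fin n) (Fin n) D) :=
      CStarMatrix.ofMatrix fun i j => CStarMatrix.ofMatrix fun p q => T (i, p) (j, q)
    have h : (star S * S).map (CStarMatrix.mapₗ ψ.toLinearMap) = star T' * T' := by
      ext i j p q
      have h1 : ψ ((star S' * S') (i, p) (j, q)) = (star T * T) (i, p) (j, q) :=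
        congrFun (congrFun hT (i, p)) (j, q)
      have h2 : (star S * S) i j p q = (star S' * S') (i, p) (j, q) := by
        rw [CStarMatrix.star_mul_self_apply, CStarMatrix.star_mul_self_apply, sum_matrix_apply,
          Fintype.sum_prod_type]
        refine Finset.sum_congr rfl fun l _ => ?_
        simp only [CStarMatrix.mul_apply, CStarMatrix.star_apply]
        rfl
      have h3 : (star T' * T') i j p q = (star T * T) (i, p) (j, q) := by
        rw [CStarMatrix.star_mul_self_apply, CStarMatrix.star_mul_self_apply, sum_matrix_apply,
          Fintype.sum_prod_type]
        refine Finset.sum_congr rfl fun l _ => ?_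
        simp only [CStarMatrix.mul_apply, CStarMatrix.star_apply]
        rfl
      rw [h3, ← h1, ← h2]
      rfl
    change 0 ≤ (star S * S).map (CStarMatrix.mapₗ ψ.toLinearMap)
    rw [h]
    exact star_mul_self_nonneg T'

theorem amplify_apply_apply (n : ℕ) (ψ : B →CP D) (M : CStarMatrix (Fin n) (Fin n) B)
    (i j : Fin n) : amplify n ψ M i j = ψ (M i j) := rfl

/-- The diagonal entry as a completely positive map. -/
noncomputable def diagonalEntry {n : ℕ} (i₀ : Fin n) : CStarMatrix (Fin n) (Fin n) D →CP D where
  toFun M := M i₀ i₀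
  map_add' _ _ := rfl
  map_smul' _ _ := rfl
  map_cstarMatrix_nonneg' k M hM := by
    obtain ⟨S, rfl⟩ := exists_eq_star_mul_self_of_nonneg hM
    let T : Fin n → CStarMatrix (Fin k) (Fin k) D :=
      fun p => CStarMatrix.ofMatrix fun l i => S l i p i₀
    have h : (star S * S).map (fun M => M i₀ i₀) = ∑ p, star (T p) * T p := by
      ext i j
      rw [sum_matrix_apply]
      change (star S * S) i j i₀ i₀ = _
      simp only [CStarMatrix.star_mul_self_apply]
      rw [sum_matrix_apply, Finset.sum_comm]
      refine Finset.sum_congr rfl fun l _ => ?_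
      simp only [CStarMatrix.mul_apply, CStarMatrix.star_apply]
      rfl
    change 0 ≤ (star S * S).map (fun M => M i₀ i₀)
    rw [h]
    exact Finset.sum_nonneg fun p _ => star_mul_self_nonneg (T p)

end CompletelyPositiveMap

theorem CStarMatrix.apply_self_nonneg {n : ℕ} {M : CStarMatrix (Fin n) (Fin n) D} (hM : 0 ≤ M)
    (i : Fin n) : 0 ≤ M i i :=
  (CompletelyPositiveMap.diagonalEntry i).map_nonneg' hM

theorem CStarMatrix.exists_apply_self_ne_zero {n : ℕ} {M : CStarMatrix (Fin n) (Fin n) D}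
    (hM : 0 ≤ M) (h0 : M ≠ 0) : ∃ i, M i i ≠ 0 := by
  by_contra! h
  obtain ⟨S, rfl⟩ := exists_eq_star_mul_self_of_nonneg hM
  have hS : S = 0 := by
    ext k i
    exact eq_zero_of_sum_star_mul_self_eq_zero
      ((CStarMatrix.star_mul_self_apply S i i).symm.trans (h i)) k (Finset.mem_univ k)
  exact h0 (by rw [hS, mul_zero])

/-- The amplification of an order zero map has order zero. -/
theorem IsOrderZero.amplify {ψ : B →CP D} (hψ : IsOrderZero ψ) (n : ℕ) :
    IsOrderZero (ψ.amplify n) := by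
  have key : ∀ a b : CStarMatrix (Fin n) (Fin n) B, a * b = 0 →
      ψ.amplify n a * ψ.amplify n b = 0 := fun a b hab => by
    ext i j
    rw [CStarMatrix.mul_apply]
    calc ∑ k, ψ (a i k) * ψ (b k j) = ∑ k, ψ (a i k * b k j) * ψ 1 :=
          Finset.sum_congr rfl fun k _ => hψ.map_mul_map _ _
      _ = ψ ((a * b) i j) * ψ 1 := by rw [← Finset.sum_mul, ← map_sum, CStarMatrix.mul_apply]
      _ = 0 := by rw [hab, CStarMatrix.zero_apply, map_zero, zero_mul]
  exact fun a b _ _ hab hba => ⟨key a b hab, key b a hba⟩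

/-- An element which commutes with `ψ 1` and represents an element of the domain commutes with the
image of the commutant of that element. -/
theorem IsOrderZero.commute_of_map_eq {ψ : B →CP D} (hψ : IsOrderZero ψ) {P : D} {p b : B}
    (hp : ψ p = P * ψ 1) (hP : P * ψ 1 = ψ 1 * P) (hpb : p * b = b * p) :
    P * ψ b = ψ b * P := by
  have hsh : star (ψ 1) = ψ 1 := by rw [← ψ.map_star', star_one]
  have hcomm : ψ 1 * ψ b = ψ b * ψ 1 := by simpa using hψ.map_mul_map 1 b
  have hnull : ∀ L : D, ψ 1 * L = 0 → star L * ψ b = 0 := fun L hL => by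
    have h1 := ψ.sum_map_mul_eq_zero 1 0 L 0 (by simp [mul_assoc, hL]) (star b)
    rw [mul_one, mul_zero, add_zero] at h1
    simpa [ψ.map_star'] using congrArg star h1
  set K := P * ψ b - ψ b * P with hK
  have hhK : ψ 1 * K = 0 := by
    rw [hK, mul_sub, ← mul_assoc, ← hP, ← hp, ← mul_assoc, hcomm, mul_assoc (ψ b), ← hP, ← hp,
      hψ.map_mul_map p b, hψ.map_mul_map b p, hpb, sub_self]
  have hPs : ψ 1 * star P = star P * ψ 1 := by
    simpa [hsh] using congrArg star hP
  have h1 := hnull K hhK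
  have h2 := hnull (star P * K) (by rw [← mul_assoc, hPs, mul_assoc, hhK, mul_zero])
  rw [star_mul, star_star] at h2
  have h3 : star K * K = 0 := by
    conv_lhs => rw [hK]
    rw [← hK, mul_sub, ← mul_assoc, h2, ← mul_assoc, h1, zero_mul, sub_zero]
  exact sub_eq_zero.1 ((CStarRing.star_mul_self_eq_zero_iff K).1 h3)

/-- If `p` and a full element `q` of the domain are orthogonal, then `1 - ψ p` is full. -/
theorem IsOrderZero.exists_sum_eq_one {ψ : B →CP D} (hψ : IsOrderZero ψ) {p q : B}
    (hpp : p * p = p) (hpq : p * q = 0) {m : ℕ} {r s : Fin m → B}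
    (hrs : ∑ i, r i * q * s i = 1) :
    ∃ u v : Fin (m + 1) → D, ∑ i, u i * (1 - ψ p) * v i = 1 := by
  have hcomm : ∀ b, ψ 1 * ψ b = ψ b * ψ 1 := fun b => by simpa using hψ.map_mul_map 1 b
  have hE : ψ 1 * ψ p = ψ p * ψ p := by rw [hψ.map_mul_map' p p, hpp]
  have hEF : ψ p * ψ q = 0 := by rw [hψ.map_mul_map, hpq, map_zero, zero_mul]
  have hF : (1 - ψ p) * ψ q = ψ q := by rw [sub_mul, one_mul, hEF, sub_zero]
  have hsum : ∑ i, ψ (r i) * ψ q * ψ (s i) = ψ 1 * ψ 1 * ψ 1 := by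
    have h1 : ∀ i, ψ (r i) * ψ q * ψ (s i) = ψ (r i * q * s i) * ψ 1 * ψ 1 := fun i => by
      rw [hψ.map_mul_map, mul_assoc, hcomm, ← mul_assoc, hψ.map_mul_map]
    simp only [h1, ← Finset.sum_mul, ← map_sum, hrs]
  have h4 : ψ 1 * ψ 1 * ψ 1 * ψ p = ψ p * ψ p * ψ p * ψ p := by
    rw [mul_assoc, hE, mul_assoc, ← mul_assoc (ψ 1) (ψ p), hE, ← mul_assoc, ← mul_assoc, hE]
  -- Put `E = ψ p`. As `E ψ q = 0`, the element `ψ q = (1 - E) ψ q` lies in the ideal of `1 - E`,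
  -- and so does `(ψ 1)³ E = E⁴`. The extra term is `(1 - E)(1 + E + E² + E³) = 1 - E⁴`.
  refine ⟨Fin.cons 1 fun i => ψ (r i),
    Fin.cons (1 + ψ p + ψ p * ψ p + ψ p * ψ p * ψ p) fun i => ψ q * ψ (s i) * ψ p, ?_⟩
  rw [Fin.sum_univ_succ]
  simp only [Fin.cons_zero, Fin.cons_succ]
  have h5 : ∀ i, ψ (r i) * (1 - ψ p) * (ψ q * ψ (s i) * ψ p) =
      ψ (r i) * ψ q * ψ (s i) * ψ p := fun i => by
    calc _ = ψ (r i) * ((1 - ψ p) * ψ q) * ψ (s i) * ψ p := by simp only [mul_assoc]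
      _ = _ := by rw [hF]
  simp only [h5, ← Finset.sum_mul, hsum, h4]
  noncomm_ring

end CompletelyPositive

/-! ### Cuntz subequivalence -/

section Cuntz

variable {D C : Type*} [CStarAlgebra D] [CStarAlgebra C]

theorem CuntzSubequiv.map (f : D →⋆ₐ[ℂ] C) {a b : D} (h : CuntzSubequiv a b) :
    CuntzSubequiv (f a) (f b) := by
  obtain ⟨z, hz⟩ := h
  refine ⟨fun k => f (z k), squeeze_zero (fun k => norm_nonneg _) (fun k => ?_) hz⟩
  rw [← map_star, ← map_mul, ← map_mul, ← map_sub]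
  exact NonUnitalStarAlgHom.norm_apply_le f _

/-- Replacing `c` by a good approximant `z x z*` moves the sum from `1` to a nearby unit, whose
inverse is absorbed on the left. The number of terms stays the same. -/
theorem CuntzSubequiv.exists_sum_eq_one {c x : D} (h : CuntzSubequiv c x) {N : ℕ}
    {u v : Fin N → D} (huv : ∑ i, u i * c * v i = 1) :
    ∃ u' v' : Fin N → D, ∑ i, u' i * x * v' i = 1 := by
  obtain ⟨z, hz⟩ := h
  have hz' : Tendsto (fun k => z k * x * star (z k)) atTop (𝓝 c) :=
    tendsto_iff_norm_sub_tendsto_zero.2 hz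
  have hlim : Tendsto (fun k => ∑ i, u i * (z k * x * star (z k)) * v i) atTop (𝓝 1) := by
    rw [← huv]
    exact tendsto_finsetSum _ fun i _ => (hz'.const_mul (u i)).mul_const (v i)
  obtain ⟨k, hk⟩ := (hlim.eventually (Units.isOpen.mem_nhds isUnit_one)).exists
  obtain ⟨w, hw⟩ := hk
  refine ⟨fun i => ↑w⁻¹ * (u i * z k), fun i => star (z k) * v i, ?_⟩
  rw [← w.inv_mul, hw, Finset.mul_sum]
  simp only [mul_assoc]

variable [PartialOrder D] [StarOrderedRing D]

/-- If the ideal generated by the positive element `x` contains the unit in the strong sense that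
`s * x * t = 1`, then `1 ≲ x`. -/
theorem CuntzSubequiv.one_of_mul_mul_eq_one {x s t : D} (hx : 0 ≤ x) (h : s * x * t = 1) :
    CuntzSubequiv 1 x := by
  set r := CFC.sqrt x with hr
  have hrr : r * r = x := CFC.sqrt_mul_sqrt_self x hx
  have hrs : star r = r := (IsSelfAdjoint.of_nonneg (CFC.sqrt_nonneg x)).star_eq
  set g := star (r * t) * (r * t) with hg
  have hgx : g = star t * x * t := by
    rw [hg, star_mul, hrs, ← hrr]; simp only [mul_assoc]
  -- From `1 = (s r)(r t)` one gets `1 ≤ ‖s r‖² t* x t`, so `g = t* x t` is invertible and `g ^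
  -- (-1/2) t*` is an exact witness.
  have hle : (1 : D) ≤ ‖s * r‖ ^ 2 • g := by
    have h1 : (1 : D) = star (r * t) * (star (s * r) * (s * r)) * (r * t) := by
      have h2 : s * r * (r * t) = 1 := by rw [← h, ← hrr]; simp only [mul_assoc]
      calc (1 : D) = star (s * r * (r * t)) * (s * r * (r * t)) := by rw [h2, star_one, one_mul]
        _ = _ := by rw [star_mul (s * r)]; simp only [mul_assoc]
    have h3 := star_left_conjugate_le_conjugate
      (CStarAlgebra.star_mul_le_algebraMap_norm_sq (a := s * r)) (r * t)
    rw [← h1, Algebra.algebraMap_eq_smul_one, mul_smul_comm, mul_one, smul_mul_assoc] at h3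
    exact h3
  have hgu : IsUnit g := by
    have h1 : IsUnit (‖s * r‖ ^ 2 • g) := CStarAlgebra.isUnit_of_le 1 hle
    rcases subsingleton_or_nontrivial D with hD | hD
    · exact isUnit_of_subsingleton _
    have h2 : ‖s * r‖ ^ 2 ≠ 0 := fun h0 => by
      rw [h0, zero_smul] at h1; exact not_isUnit_zero h1
    simpa [smul_smul, h2] using (IsUnit.smul (Units.mk0 _ (inv_ne_zero h2)) h1)
  obtain ⟨w, hw⟩ := hgu
  have hgs : star g = g := by rw [hg]; simp
  have hwi : star (↑w⁻¹ : D) = ↑w⁻¹ := by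
    have h1 : (w : D) * star (↑w⁻¹ : D) = 1 := by
      nth_rw 1 [hw, ← hgs, ← star_mul, ← hw, w.inv_mul, star_one]
    rw [← one_mul (star (↑w⁻¹ : D)), ← w.inv_mul, mul_assoc, h1, mul_one]
  have hwn : 0 ≤ (↑w⁻¹ : D) := by
    have h1 : (↑w⁻¹ : D) = star (r * t * ↑w⁻¹) * (r * t * ↑w⁻¹) := by
      calc (↑w⁻¹ : D) = ↑w⁻¹ * g * ↑w⁻¹ := by rw [← hw, w.inv_mul, one_mul]
        _ = _ := by rw [star_mul, hwi, hg]; simp only [mul_assoc]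
    rw [h1]
    exact star_mul_self_nonneg _
  set k := CFC.sqrt (↑w⁻¹ : D) with hk
  have hkk : k * k = ↑w⁻¹ := CFC.sqrt_mul_sqrt_self _ hwn
  have hks : star k = k := (IsSelfAdjoint.of_nonneg (CFC.sqrt_nonneg _)).star_eq
  have hone : k * star t * x * star (k * star t) - 1 = 0 := by
    rw [star_mul, star_star, hks, sub_eq_zero]
    calc k * star t * x * (t * k) = k * g * k := by rw [hgx]; simp only [mul_assoc]
      -- Inserting `(k * k) * g = 1` avoids having to show that `k` commutes with `g`.
      _ = k * g * k * ((k * k) * g) := by rw [hkk, ← hw, w.inv_mul, mul_one]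
      _ = k * (g * (k * k)) * (k * g) := by simp only [mul_assoc]
      _ = 1 := by
        rw [hkk, ← hw, w.mul_inv, mul_one, ← mul_assoc, hkk, w.inv_mul]
  exact ⟨fun _ => k * star t, by simp only [hone, norm_zero, tendsto_const_nhds]⟩

end Cuntz

/-! ### Reformulation for matrix amplifications -/

section Reformulation

variable {D : Type*} [CStarAlgebra D] [PartialOrder D] [StarOrderedRing D] {n : ℕ}

omit [PartialOrder D] [StarOrderedRing D] in
theorem mul_scalarHom_apply (M : CStarMatrix (Fin n) (Fin n) D) (e : D) (i j : Fin n) :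
    (M * scalarHom n D e) i j = M i j * e := by
  simp [CStarMatrix.mul_apply, scalarHom_apply_apply]

omit [PartialOrder D] [StarOrderedRing D] in
theorem scalarHom_mul_apply (M : CStarMatrix (Fin n) (Fin n) D) (e : D) (i j : Fin n) :
    (scalarHom n D e * M) i j = e * M i j := by
  simp [CStarMatrix.mul_apply, scalarHom_apply_apply]

omit [PartialOrder D] [StarOrderedRing D] in
theorem mul_elemTensor_single_mul_apply (U V : CStarMatrix (Fin n) (Fin n) D) (x : D)
    (k l i j : Fin n) :
    (U * elemTensor x (Matrix.single k l 1) * V) i j = U i k * x * V l j := by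
  simp [CStarMatrix.mul_apply, elemTensor_apply, Matrix.single_apply, ite_smul, ite_and]

omit [PartialOrder D] [StarOrderedRing D] in
/-- The commutant of `1 ⊗ M_n` consists of the matrices `a ⊗ 1`. -/
theorem eq_scalarHom_of_commute [NeZero n] {C : CStarMatrix (Fin n) (Fin n) D}
    (h : ∀ m : Matrix (Fin n) (Fin n) ℂ, elemTensor 1 m * C = C * elemTensor 1 m) :
    C = scalarHom n D (C 0 0) := by
  ext i j
  have h1 := congrFun (congrFun (h (Matrix.single j 0 1)) j) j
  -- The `(i, 0)` entry of `e_{j0} C = C e_{j0}` reads `δ_ij C₀₀ = C_ij`.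
  have h2 := congrFun (congrFun (h (Matrix.single j 0 1)) i) 0
  simp only [CStarMatrix.mul_apply, elemTensor_apply, Matrix.single_apply, ite_smul, one_smul,
    zero_smul, ite_mul, mul_ite, one_mul, zero_mul, mul_one, mul_zero, ite_and,
    Finset.sum_ite_eq, Finset.mem_univ, if_true] at h1 h2
  rw [scalarHom_apply_apply]
  simpa [eq_comm] using h2.symm

theorem elemTensor_single_nonneg {x : D} (hx : 0 ≤ x) (k : Fin n) :
    0 ≤ (elemTensor x (Matrix.single k k 1) : CStarMatrix (Fin n) (Fin n) D) := by
  obtain ⟨s, rfl⟩ := exists_eq_star_mul_self_of_nonneg hx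
  have h : (elemTensor (star s * s) (Matrix.single k k 1) : CStarMatrix (Fin n) (Fin n) D) =
      star (elemTensor s (Matrix.single k k 1)) * elemTensor s (Matrix.single k k 1) := by
    rw [star_elemTensor, elemTensor_mul]
    congr 1
    simp [Matrix.star_eq_conjTranspose]
  rw [h]
  exact star_mul_self_nonneg _

omit [PartialOrder D] [StarOrderedRing D] in
theorem elemTensor_single_ne_zero {x : D} (hx : x ≠ 0) (k : Fin n) :
    (elemTensor x (Matrix.single k k 1) : CStarMatrix (Fin n) (Fin n) D) ≠ 0 := fun h => by
  apply hx
  have h1 := congrFun (congrFun h k) k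
  simpa [elemTensor_apply] using h1

variable {ω : Ultrafilter ℕ} {G : Type*} [Group G]
    {A : Type*} [CStarAlgebra A] [PartialOrder A] [StarOrderedRing A] [Nontrivial A]
    {B : Type*} [CStarAlgebra B] [PartialOrder B] [StarOrderedRing B]
    {α : G →* (A ≃⋆ₐ[ℂ] A)} {β : G →* (B ≃⋆ₐ[ℂ] B)} {φ : EquivariantStarHom α β}
    [NeZero n] {ρ : G →* (Matrix (Fin n) (Fin n) ℂ ≃⋆ₐ[ℂ] Matrix (Fin n) (Fin n) ℂ)}

/-- The property of being tracially sequentially-split by order zero for `φ ⊗ id`, expressed in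
`M_n(A_ω)` instead of `M_n(A)_ω`. -/
theorem isTraciallySeqSplitOrderZero_tensorMatrix_iff :
    IsTraciallySeqSplitOrderZero ω (φ.tensorMatrix ρ) ↔
      ∀ X : CStarMatrix (Fin n) (Fin n) (Ultrapower ω A), 0 ≤ X → X ≠ 0 →
        ∃ (Ψ : CStarMatrix (Fin n) (Fin n) B →CP CStarMatrix (Fin n) (Fin n) (Ultrapower ω A))
          (E : CStarMatrix (Fin n) (Fin n) (Ultrapower ω A)),
          IsOrderZero Ψ ∧
          (∀ g b, Ψ (tensorAction β ρ g b) =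
            tensorAction (Ultrapower.action ω α) ρ g (Ψ b)) ∧
          0 ≤ E ∧
          (∀ M, CStarMatrix.mapₙₐ (Ultrapower.diag ω A : A →⋆ₙₐ[ℂ] Ultrapower ω A) M * E =
            E * CStarMatrix.mapₙₐ (Ultrapower.diag ω A : A →⋆ₙₐ[ℂ] Ultrapower ω A) M) ∧
          (∀ M, Ψ (CStarMatrix.mapₙₐ φ.toHom M) =
            CStarMatrix.mapₙₐ (Ultrapower.diag ω A : A →⋆ₙₐ[ℂ] Ultrapower ω A) M * E) ∧
          CuntzSubequiv (1 - E) X := by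
  set Θ := Ultrapower.matrixEquiv ω n A with hΘ
  have hinj : Function.Injective Θ := EquivLike.injective Θ
  let F : Ultrapower ω (CStarMatrix (Fin n) (Fin n) A) →⋆ₐ[ℂ]
    CStarMatrix (Fin n) (Fin n) (Ultrapower ω A) := Θ
  let F' : CStarMatrix (Fin n) (Fin n) (Ultrapower ω A) →⋆ₐ[ℂ]
    Ultrapower ω (CStarMatrix (Fin n) (Fin n) A) := Θ.symm
  constructor
  · intro h X hX hX0
    obtain ⟨Ψ, E, h1, h2, h3, h4, h5, h6⟩ := h (Θ.symm X) (map_nonneg Θ.symm hX)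
      (fun h0 => hX0 (by rw [← Θ.apply_symm_apply X, h0, map_zero]))
    refine ⟨(CompletelyPositiveMap.ofStarHom F).comp Ψ, Θ E, fun a b ha hb hab hba => ?_, fun g b => ?_,
      map_nonneg Θ h3, fun M => ?_, fun M => ?_, ?_⟩
    · obtain ⟨h7, h8⟩ := h1 a b ha hb hab hba
      constructor
      · change Θ (Ψ a) * Θ (Ψ b) = 0
        rw [← map_mul, h7, map_zero]
      · change Θ (Ψ b) * Θ (Ψ a) = 0
        rw [← map_mul, h8, map_zero]
    · change Θ (Ψ _) = _
      rw [h2, hΘ, Ultrapower.matrixEquiv_action]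
      rfl
    · rw [← Ultrapower.matrixEquiv_diag, ← map_mul, ← map_mul, h4]
    · rw [← Ultrapower.matrixEquiv_diag, ← map_mul, ← h5]
      rfl
    · have h7 := h6.map F
      change CuntzSubequiv (Θ (1 - E)) (Θ (Θ.symm X)) at h7
      rwa [map_sub, map_one, Θ.apply_symm_apply] at h7
  · intro h X hX hX0
    obtain ⟨Ψ, E, h1, h2, h3, h4, h5, h6⟩ := h (Θ X) (map_nonneg Θ hX)
      (fun h0 => hX0 (by rw [← Θ.symm_apply_apply X, h0, map_zero]))
    refine ⟨(CompletelyPositiveMap.ofStarHom F').comp Ψ, Θ.symm E, fun a b ha hb hab hba => ?_,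
      fun g b => ?_, map_nonneg Θ.symm h3, fun M => ?_, fun M => ?_, ?_⟩
    · obtain ⟨h7, h8⟩ := h1 a b ha hb hab hba
      constructor
      · change Θ.symm (Ψ a) * Θ.symm (Ψ b) = 0
        rw [← map_mul, h7, map_zero]
      · change Θ.symm (Ψ b) * Θ.symm (Ψ a) = 0
        rw [← map_mul, h8, map_zero]
    · change Θ.symm (Ψ _) = Ultrapower.action ω (tensorAction α ρ) g (Θ.symm (Ψ b))
      apply hinj
      rw [h2, hΘ, Ultrapower.matrixEquiv_action, ← hΘ, Θ.apply_symm_apply, Θ.apply_symm_apply]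
    · apply hinj
      rw [map_mul, map_mul, Θ.apply_symm_apply, hΘ, Ultrapower.matrixEquiv_diag, h4]
    · apply hinj
      change Θ (Θ.symm (Ψ _)) = _
      rw [map_mul, Θ.apply_symm_apply, Θ.apply_symm_apply, hΘ, Ultrapower.matrixEquiv_diag, ← h5]
      rfl
    · have h7 := h6.map F'
      change CuntzSubequiv (Θ.symm (1 - E)) (Θ.symm (Θ X)) at h7
      rwa [map_sub, map_one, Θ.symm_apply_apply] at h7

end Reformulation

/-! ### The two implications -/

section Main

variable {ω : Ultrafilter ℕ} {G : Type*} [Group G]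
    {A : Type*} [CStarAlgebra A] [PartialOrder A] [StarOrderedRing A] [Nontrivial A]
    {B : Type*} [CStarAlgebra B] [PartialOrder B] [StarOrderedRing B]
    {α : G →* (A ≃⋆ₐ[ℂ] A)} {β : G →* (B ≃⋆ₐ[ℂ] B)} {φ : EquivariantStarHom α β}
    {n : ℕ} [NeZero n] {ρ : G →* (Matrix (Fin n) (Fin n) ℂ ≃⋆ₐ[ℂ] Matrix (Fin n) (Fin n) ℂ)}

omit [PartialOrder A] [StarOrderedRing A] [NeZero n] in
theorem mapₙₐ_diag_elemTensor (a : A) (m : Matrix (Fin n) (Fin n) ℂ) :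
    CStarMatrix.mapₙₐ (Ultrapower.diag ω A : A →⋆ₙₐ[ℂ] Ultrapower ω A) (elemTensor a m) =
      elemTensor (Ultrapower.diag ω A a) m :=
  mapₙₐ_elemTensor _ a m

/-- The property of being tracially sequentially-split by order zero passes to `φ ⊗ id`. -/
theorem IsTraciallySeqSplitOrderZero.tensorMatrix (hA : IsSimpleCStarAlgebra A)
    (hdim : ¬ FiniteDimensional ℂ A) (h : IsTraciallySeqSplitOrderZero ω φ) :
    IsTraciallySeqSplitOrderZero ω (φ.tensorMatrix ρ) := by
  rw [isTraciallySeqSplitOrderZero_tensorMatrix_iff]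
  intro X hX hX0
  obtain ⟨i, hi⟩ := CStarMatrix.exists_apply_self_ne_zero hX hX0
  obtain ⟨y, w, hy, hy0, hw⟩ := Ultrapower.exists_orthogonal_copies ω hA hdim n
    (CStarMatrix.apply_self_nonneg hX i) hi
  obtain ⟨ψ, e, h1, h2, h3, h4, h5, z, hz⟩ := h y hy hy0
  refine ⟨ψ.amplify n, scalarHom n _ e, h1.amplify n, fun g M => ?_, map_nonneg _ h3,
    fun M => ?_, fun M => ?_, ?_⟩
  · ext k l
    rw [CompletelyPositiveMap.amplify_apply_apply]
    change ψ ((∑ p, ∑ q, elemTensor (β g (M p q)) (ρ g (Matrix.single p q 1))) k l) =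
      (∑ p, ∑ q, elemTensor (Ultrapower.action ω α g (ψ (M p q)))
        (ρ g (Matrix.single p q 1))) k l
    simp only [sum_matrix_apply, elemTensor_apply, map_sum, map_smul, h2]
  · ext k l
    rw [mul_scalarHom_apply, scalarHom_mul_apply]
    exact h4 (M k l)
  · ext k l
    rw [mul_scalarHom_apply]
    exact h5 (M k l)
  · let Z : ℕ → CStarMatrix (Fin n) (Fin n) (Ultrapower ω A) := fun m =>
      CStarMatrix.ofMatrix fun a b => if b = i then z m * star (w a) else 0
    have hZ : ∀ m, Z m * X * star (Z m) - (1 - scalarHom n _ e) =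
        scalarHom n _ (z m * y * star (z m) - (1 - e)) := fun m => by
      have h6 : Z m * X * star (Z m) = scalarHom n _ (z m * y * star (z m)) := by
        ext a b
        have hZa : ∀ a b, Z m a b = if b = i then z m * star (w a) else 0 := fun _ _ => rfl
        have h7 : (Z m * X * star (Z m)) a b = z m * (star (w a) * X i i * w b) * star (z m) := by
          simp [CStarMatrix.mul_apply, CStarMatrix.star_apply, hZa, apply_ite star, mul_assoc]
        rw [h7, hw, scalarHom_apply_apply]
        split_ifs <;> simp
      rw [h6, map_sub, map_sub, map_one]
    refine ⟨Z, squeeze_zero (fun m => norm_nonneg _) (fun m => ?_) hz⟩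
    rw [hZ]
    exact NonUnitalStarAlgHom.norm_apply_le (scalarHom n (Ultrapower ω A)) _

/-- If `φ` is not unital and `φ ⊗ id` is tracially sequentially-split by order zero, then every
nonzero positive element of the ultrapower dominates the unit. -/
theorem IsTraciallySeqSplitOrderZero.one_cuntzSubequiv (hA : IsSimpleCStarAlgebra A)
    (hdim : ¬ FiniteDimensional ℂ A) (hB : IsSimpleCStarAlgebra B) (hφ : φ.toHom 1 ≠ 1)
    (h : IsTraciallySeqSplitOrderZero ω (φ.tensorMatrix ρ)) {x : Ultrapower ω A} (hx : 0 ≤ x)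
    (hx0 : x ≠ 0) : CuntzSubequiv 1 x := by
  rw [isTraciallySeqSplitOrderZero_tensorMatrix_iff] at h
  obtain ⟨m, r, s, hrs⟩ := hB.exists_sum_eq_one (sub_ne_zero.2 hφ.symm)
  -- The length `m + 1` of the sum expressing fullness of `1 - E` is known before `Ψ` is chosen, so
  -- `y` can be taken with that many orthogonal copies below `x`.
  obtain ⟨y, w, hy, hy0, hw⟩ := Ultrapower.exists_orthogonal_copies ω hA hdim (m + 1) hx hx0
  obtain ⟨Ψ, E, h1, -, -, -, h5, h6⟩ := h _ (elemTensor_single_nonneg hy (0 : Fin n))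
    (elemTensor_single_ne_zero hy0 0)
  have hpp : φ.toHom 1 * φ.toHom 1 = φ.toHom 1 := by rw [← map_mul, one_mul]
  have hΨp : Ψ (scalarHom n B (φ.toHom 1)) = E := by
    have h7 := h5 (elemTensor 1 1)
    rwa [mapₙₐ_diag_elemTensor, mapₙₐ_elemTensor, map_one (Ultrapower.diag ω A), elemTensor_one_one, one_mul] at h7
  obtain ⟨u, v, huv⟩ := h1.exists_sum_eq_one (p := scalarHom n B (φ.toHom 1))
    (q := scalarHom n B (1 - φ.toHom 1)) (r := fun i => scalarHom n B (r i))
    (s := fun i => scalarHom n B (s i)) (by rw [← map_mul, hpp])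
    (by rw [← map_mul, mul_sub, mul_one, hpp, sub_self, map_zero])
    (by simp only [← map_mul, ← map_sum, hrs, map_one])
  rw [hΨp] at huv
  obtain ⟨u', v', huv'⟩ := h6.exists_sum_eq_one huv
  have h00 : ∑ i, u' i 0 0 * y * v' i 0 0 = 1 := by
    have h7 := congrFun (congrFun huv' 0) 0
    rw [sum_matrix_apply] at h7
    simpa only [mul_elemTensor_single_mul_apply, CStarMatrix.one_apply_eq] using h7
  -- Orthogonality of the copies kills the cross terms, so the sum of `m + 1` products through `y`
  -- becomes a single product through `x`.
  refine CuntzSubequiv.one_of_mul_mul_eq_one (s := ∑ i, u' i 0 0 * star (w i))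
    (t := ∑ j, w j * v' j 0 0) hx ?_
  rw [Finset.sum_mul, Finset.sum_mul_sum, ← h00]
  refine Finset.sum_congr rfl fun i _ => ?_
  have h8 : ∀ j, u' i 0 0 * star (w i) * x * (w j * v' j 0 0) =
      u' i 0 0 * (star (w i) * x * w j) * v' j 0 0 := fun j => by simp only [mul_assoc]
  simp [h8, hw]

/-- If `φ` is unital, the order zero maps of `φ ⊗ id` are amplifications. -/
theorem IsTraciallySeqSplitOrderZero.of_tensorMatrix_of_unital (hφ : φ.toHom 1 = 1)
    (h : IsTraciallySeqSplitOrderZero ω (φ.tensorMatrix ρ)) :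
    IsTraciallySeqSplitOrderZero ω φ := by
  rw [isTraciallySeqSplitOrderZero_tensorMatrix_iff] at h
  intro x hx hx0
  obtain ⟨Ψ, E, h1, h2, h3, h4, h5, z, hz⟩ := h _ (elemTensor_single_nonneg hx (0 : Fin n))
    (elemTensor_single_ne_zero hx0 0)
  have hEcomm : ∀ m : Matrix (Fin n) (Fin n) ℂ, elemTensor 1 m * E = E * elemTensor 1 m :=
    fun m => by simpa only [mapₙₐ_diag_elemTensor, map_one] using h4 (elemTensor 1 m)
  have hΨm : ∀ m : Matrix (Fin n) (Fin n) ℂ, Ψ (elemTensor 1 m) = elemTensor 1 m * E :=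
    fun m => by
      have h7 := h5 (elemTensor 1 m)
      rwa [mapₙₐ_diag_elemTensor, mapₙₐ_elemTensor, hφ, map_one (Ultrapower.diag ω A)] at h7
  have hΨ1 : Ψ 1 = E := by simpa only [elemTensor_one_one, one_mul] using hΨm 1
  have hE : E = scalarHom n _ (E 0 0) := eq_scalarHom_of_commute hEcomm
  let ψ : B →CP Ultrapower ω A :=
    (CompletelyPositiveMap.diagonalEntry (0 : Fin n)).comp (Ψ.comp (CompletelyPositiveMap.ofStarHom (scalarHom n B)))
  -- `Ψ (1 ⊗ m) = (1 ⊗ m) Ψ 1`, and `1 ⊗ m` commutes with `b ⊗ 1`; hence `Ψ (b ⊗ 1)` lies in the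
  -- commutant of `1 ⊗ M_n`.
  have hψ : ∀ b, Ψ (scalarHom n B b) = scalarHom n _ (ψ b) := fun b =>
    eq_scalarHom_of_commute fun m => h1.commute_of_map_eq (p := elemTensor 1 m)
      (by rw [hΨ1, hΨm]) (by rw [hΨ1, hEcomm])
      (by rw [scalarHom_apply, elemTensor_mul, elemTensor_mul]; simp)
  have hinj : Function.Injective (scalarHom n (Ultrapower ω A)) := fun a b hab => by
    simpa [scalarHom_apply_apply] using congrFun (congrFun hab 0) 0
  refine ⟨ψ, E 0 0, fun a b ha hb hab hba => ?_, fun g b => hinj ?_,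
    CStarMatrix.apply_self_nonneg h3 0, fun a => hinj ?_, fun a => hinj ?_, ?_⟩
  · obtain ⟨h7, h8⟩ := h1 (scalarHom n B a) (scalarHom n B b) (map_nonneg _ ha) (map_nonneg _ hb)
      (by rw [← map_mul, hab, map_zero]) (by rw [← map_mul, hba, map_zero])
    rw [hψ, hψ, ← map_mul] at h7 h8
    exact ⟨hinj (h7.trans (map_zero _).symm), hinj (h8.trans (map_zero _).symm)⟩
  · have h7 := h2 g (scalarHom n B b)
    rw [hψ, scalarHom_apply, scalarHom_apply, tensorAction_elemTensor, tensorAction_elemTensor,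
      map_one, ← scalarHom_apply, ← scalarHom_apply, hψ] at h7
    exact h7
  · have h7 := h4 (elemTensor a 1)
    rw [mapₙₐ_diag_elemTensor, ← scalarHom_apply, hE] at h7
    rwa [map_mul, map_mul]
  · have h7 := h5 (elemTensor a 1)
    rw [mapₙₐ_diag_elemTensor, mapₙₐ_elemTensor, ← scalarHom_apply, ← scalarHom_apply, hψ, hE] at h7
    rwa [map_mul]
  -- The `(0, 0)` entry of `z (x ⊗ e₀₀) z*` involves only `z₀₀`, and taking an entry does not
  -- increase the norm.
  · refine ⟨fun m => z m 0 0, squeeze_zero (fun m => norm_nonneg _) (fun m => ?_) hz⟩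
    have h7 : z m 0 0 * x * star (z m 0 0) - (1 - E 0 0) =
        (z m * elemTensor x (Matrix.single 0 0 1) * star (z m) - (1 - E) :
          CStarMatrix (Fin n) (Fin n) (Ultrapower ω A)) 0 0 := by
      rw [CStarMatrix.sub_apply, mul_elemTensor_single_mul_apply, CStarMatrix.sub_apply,
        CStarMatrix.one_apply_eq, CStarMatrix.star_apply]
    rw [h7]
    exact CStarMatrix.norm_entry_le_norm

/-- When `φ` is not unital, `1 ≲ x` for every nonzero positive `x`, so the zero map with `e = 0`
meets all the conditions. -/
theorem IsTraciallySeqSplitOrderZero.of_tensorMatrix (hA : IsSimpleCStarAlgebra A)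
    (hdim : ¬ FiniteDimensional ℂ A) (hB : IsSimpleCStarAlgebra B)
    (h : IsTraciallySeqSplitOrderZero ω (φ.tensorMatrix ρ)) :
    IsTraciallySeqSplitOrderZero ω φ := by
  by_cases hφ : φ.toHom 1 = 1
  · exact h.of_tensorMatrix_of_unital hφ
  intro x hx hx0
  refine ⟨CompletelyPositiveMap.zero _ _, 0, fun a b _ _ _ _ => ?_, fun g b => ?_, le_rfl,
    fun a => ?_, fun a => ?_, ?_⟩
  · simp [CompletelyPositiveMap.zero_apply]
  · simp [CompletelyPositiveMap.zero_apply]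
  · simp
  · simp [CompletelyPositiveMap.zero_apply]
  · rw [sub_zero]
    exact h.one_cuntzSubequiv hA hdim hB hφ hx hx0

end Main

theorem lemmaL (ω : Ultrafilter ℕ) (hω : (ω : Filter ℕ) ≤ Filter.cofinite)
    {G : Type*} [Group G] [Finite G]
    {A : Type*} [CStarAlgebra A] [PartialOrder A] [StarOrderedRing A] [Nontrivial A]
    {B : Type*} [CStarAlgebra B] [PartialOrder B] [StarOrderedRing B]
    [TopologicalSpace.SeparableSpace A] [TopologicalSpace.SeparableSpace B]
    (hA : IsSimpleCStarAlgebra A) (hB : IsSimpleCStarAlgebra B)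
    (hA_dim : ¬ FiniteDimensional ℂ A) (hB_dim : ¬ FiniteDimensional ℂ B)
    (α : G →* (A ≃⋆ₐ[ℂ] A)) (β : G →* (B ≃⋆ₐ[ℂ] B)) (φ : EquivariantStarHom α β)
    (n : ℕ) [NeZero n]
    (ρ : G →* (Matrix (Fin n) (Fin n) ℂ ≃⋆ₐ[ℂ] Matrix (Fin n) (Fin n) ℂ)) :
    IsTraciallySeqSplitOrderZero ω φ ↔
      IsTraciallySeqSplitOrderZero ω (φ.tensorMatrix ρ) :=
  ⟨fun h => h.tensorMatrix hA hA_dim, fun h => h.of_tensorMatrix hA hA_dim hB⟩
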